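/- Let $A$ and $V$ be smooth finite-dimensional manifolds without boundary, with $V$ non-empty, and let $\mu:A\to V$ be a smooth principal $\mathbb R$-bundle with principal action $\psi:\mathbb R\times A\to A$ and infinitesimal generator $Z_\mu(a)=\frac{d}{ds}\big|_{s=0}\psi(s,a)$. Let $\Omega$ be a symplectic form on $A$ such that $\psi_s^*\Omega=\Omega$ for every $s\in\mathbb R$, where $\psi_s=\psi(s,\cdot)$, and let $h:V\to A$ be a smooth map with $\mu\circ h=\mathrm{id}_V$ (so $(A,\mu,\Omega,h)$ is a non-autonomous Hamiltonian system). Let $F_h:A\to\mathbb R$ be the unique function with $$a=\psi\big(F_h(a),h(\mu(a))\big)\qquad\text{for all }a\in A,$$ and let $\mathcal H_{F_h}$ be its Hamiltonian vector field, $i_{\mathcal H_{F_h}}\Omega=dF_h$. Put $$\omega_h=h^*\Omega,\qquad \eta_h=-h^*(i_{Z_\mu}\Omega).$$ Then: 1. $(\omega_h,\eta_h)$ is a cosymplectic structure on $V$: $\omega_h$ is a smooth closed $2$-form, $\eta_h$ is a smooth closed $1$-form, $\dim V=2n+1$ for some $n\ge 0$, and $\eta_h\wedge\omega_h^n$ is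 a volume form on $V$ (it vanishes nowhere). 2. $F_h$ and $\mathcal H_{F_h}$ are smooth, and $\mathcal H_{F_h}$ is $\mu$-projectable: there is a vector field $\mathcal R_h$ on $V$ with $T_a\mu(\mathcal H_{F_h}(a))=\mathcal R_h(\mu(a))$ for all $a\in A$. This $\mathcal R_h$ is the Reeb vector field of $(\omega_h,\eta_h)$, that is, the unique smooth vector field on $V$ with $i_{\mathcal R_h}\omega_h=0$ and $i_{\mathcal R_h}\eta_h=1$. -/

import Mathlib

open scoped Manifold ContDiff

/-! ## Exterior algebra of a real vector space -/

/-- The wedge product of two alternating forms, with the shuffle normalization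
`(α ∧ β)(v₁, …, v_{k+l}) = ∑ sign(σ) α(v_{σ 1}, …, v_{σ k}) β(v_{σ (k+1)}, …, v_{σ (k+l)})`, the sum
running over the `(k, l)`-shuffles `σ`. -/
noncomputable def wedge {W : Type*} [AddCommGroup W] [Module ℝ W] {k l : ℕ}
    (α : W [⋀^Fin k]→ₗ[ℝ] ℝ) (β : W [⋀^Fin l]→ₗ[ℝ] ℝ) : W [⋀^Fin (k + l)]→ₗ[ℝ] ℝ :=
  ((LinearMap.mul' ℝ ℝ).compAlternatingMap (α.domCoprod β)).domDomCongr finSumFinEquiv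

/-- The `n`-th wedge power `α ∧ ⋯ ∧ α` of a `2`-form; the power `0` is the constant `1`. -/
noncomputable def wedgePow {W : Type*} [AddCommGroup W] [Module ℝ W]
    (α : W [⋀^Fin 2]→ₗ[ℝ] ℝ) : (n : ℕ) → W [⋀^Fin (2 * n)]→ₗ[ℝ] ℝ
  | 0 => haveI : IsEmpty (Fin (2 * 0)) := inferInstanceAs (IsEmpty (Fin 0))
    AlternatingMap.constOfIsEmpty ℝ W (Fin (2 * 0)) 1
  | n + 1 => wedge (wedgePow α n) α

/-! ## Vector fields and differential forms on manifolds -/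

section Forms

variable {E : Type*} [NormedAddCommGroup E] [NormedSpace ℝ E]
  {F : Type*} [NormedAddCommGroup F] [NormedSpace ℝ F]
  {M : Type*} [TopologicalSpace M] [ChartedSpace E M]
  {N : Type*} [TopologicalSpace N] [ChartedSpace F N]

/-- Smooth vector fields. -/
def IsSmoothVectorField [IsManifold 𝓘(ℝ, E) ∞ M] (X : (x : M) → TangentSpace 𝓘(ℝ, E) x) : Prop :=
  ContMDiff 𝓘(ℝ, E) 𝓘(ℝ, E).tangent ∞ (fun x => (⟨x, X x⟩ : TangentBundle 𝓘(ℝ, E) M))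

variable (E M) in
/-- Fields of alternating `k`-forms on the tangent spaces of `M` (no regularity imposed). -/
abbrev DiffForm (k : ℕ) : Type _ :=
  (x : M) → TangentSpace 𝓘(ℝ, E) x [⋀^Fin k]→L[ℝ] ℝ

namespace DiffForm

/-- The pullback `f^* α`. -/
noncomputable def pullback {k : ℕ} (f : M → N) (α : DiffForm F N k) : DiffForm E M k :=
  fun x => (α (f x)).compContinuousLinearMap (mfderiv 𝓘(ℝ, E) 𝓘(ℝ, F) f x)

/-- The interior product `i_X α = α(X, ·, …, ·)`. -/
noncomputable def interior {k : ℕ} (X : (x : M) → TangentSpace 𝓘(ℝ, E) x)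
    (α : DiffForm E M (k + 1)) : DiffForm E M k :=
  fun x => ContinuousAlternatingMap.curryLeft (𝕜 := ℝ) (E := E) (α x) (X x)

theorem interior_apply {k : ℕ} (X : (x : M) → TangentSpace 𝓘(ℝ, E) x)
    (α : DiffForm E M (k + 1)) (x : M) (v : Fin k → TangentSpace 𝓘(ℝ, E) x) :
    interior X α x v = α x (Matrix.vecCons (X x) v) := rfl

/-- The expression of `α` in the chart of `M` at `x₀`: the pullback of `α` by the inverse of the
chart. It is meaningful on the target of the chart, an open subset of `E`. -/
noncomputable def inChart {k : ℕ} (α : DiffForm E M k) (x₀ : M) (y : E) : E [⋀^Fin k]→L[ℝ] ℝ :=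
  (α ((chartAt E x₀).symm y)).compContinuousLinearMap
    (mfderiv 𝓘(ℝ, E) 𝓘(ℝ, E) (chartAt E x₀).symm y)

/-- Smooth differential forms: all chart expressions are smooth. -/
def IsSmooth {k : ℕ} (α : DiffForm E M k) : Prop :=
  ∀ x₀ : M, ContDiffOn ℝ ∞ (inChart α x₀) (chartAt E x₀).target

/-- The exterior derivative `dα`: at `x`, compute the exterior derivative of the expression of `α`
in the chart at `x` and transport it back to the tangent space at `x`. -/
noncomputable def extDer {k : ℕ} (α : DiffForm E M k) : DiffForm E M (k + 1) :=
  fun x => (extDeriv (inChart α x) (chartAt E x x)).compContinuousLinearMap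
    (mfderiv 𝓘(ℝ, E) 𝓘(ℝ, E) (chartAt E x) x)

/-- Closed forms: `dα = 0`. -/
def IsClosed {k : ℕ} (α : DiffForm E M k) : Prop :=
  ∀ x : M, extDer α x = 0

end DiffForm

/-- A symplectic form: a smooth closed nondegenerate `2`-form. -/
structure IsSymplectic (Ω : DiffForm E M 2) : Prop where
  smooth : Ω.IsSmooth
  closed : Ω.IsClosed
  nondegenerate : ∀ (x : M) (v : TangentSpace 𝓘(ℝ, E) x),
    (∀ w : TangentSpace 𝓘(ℝ, E) x, Ω x ![v, w] = 0) → v = 0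

/-- A cosymplectic structure on `M`: a pair of a smooth closed `2`-form `ω₂` and a smooth closed
`1`-form `η₁` on the manifold `M` of odd dimension `2 n + 1`, such that `η₁ ∧ ω₂ ^ n` is a volume form,
that is, vanishes nowhere. -/
structure IsCosymplectic (ω₂ : DiffForm E M 2) (η₁ : DiffForm E M 1) : Prop where
  smooth_two : ω₂.IsSmooth
  smooth_one : η₁.IsSmooth
  closed_two : ω₂.IsClosed
  closed_one : η₁.IsClosed
  volume : ∃ n : ℕ, Module.finrank ℝ E = 2 * n + 1 ∧
    ∀ x : M, wedge (η₁ x).toAlternatingMap (wedgePow (ω₂ x).toAlternatingMap n) ≠ 0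

/-- `R` is a Reeb vector field of `(ω₂, η₁)`: `i_R ω₂ = 0` and `i_R η₁ = 1`. -/
structure IsReebVectorField [IsManifold 𝓘(ℝ, E) ∞ M] (ω₂ : DiffForm E M 2) (η₁ : DiffForm E M 1)
    (R : (x : M) → TangentSpace 𝓘(ℝ, E) x) : Prop where
  smooth : IsSmoothVectorField R
  interior_two : ∀ x : M, DiffForm.interior R ω₂ x = 0
  interior_one : ∀ x : M, η₁ x ![R x] = 1

theorem IsSymplectic.existsUnique_hamiltonian [FiniteDimensional ℝ E] {Ω : DiffForm E M 2}
    (hΩ : IsSymplectic Ω) (f : M → ℝ) (x : M) :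
    ∃! v : TangentSpace 𝓘(ℝ, E) x, ∀ w : TangentSpace 𝓘(ℝ, E) x,
      Ω x ![v, w] = (mfderiv 𝓘(ℝ, E) 𝓘(ℝ, ℝ) f x w : ℝ) := by
  have hfin : FiniteDimensional ℝ (TangentSpace 𝓘(ℝ, E) x) := inferInstanceAs
    (FiniteDimensional ℝ E)
  have e0 : ∀ v w u : TangentSpace 𝓘(ℝ, E) x, Function.update ![v, w] 0 u = ![u, w] := by
    intro v w u; funext i; fin_cases i <;> rfl
  have e1 : ∀ v w u : TangentSpace 𝓘(ℝ, E) x, Function.update ![v, w] 1 u = ![v, u] := by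
    intro v w u; funext i; fin_cases i <;> rfl
  let L : TangentSpace 𝓘(ℝ, E) x →ₗ[ℝ] Module.Dual ℝ (TangentSpace 𝓘(ℝ, E) x) :=
    LinearMap.mk₂ ℝ (fun v w => Ω x ![v, w])
      (fun v v' w => by
        have h := (Ω x).map_update_add ![v, w] 0 v v'
        rwa [e0, e0, e0] at h)
      (fun c v w => by
        have h := (Ω x).map_update_smul ![v, w] 0 c v
        rwa [e0, e0] at h)
      (fun v w w' => by
        have h := (Ω x).map_update_add ![v, w] 1 w w'
        rwa [e1, e1, e1] at h)
      (fun c v w => by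
        have h := (Ω x).map_update_smul ![v, w] 1 c w
        rwa [e1, e1] at h)
  have hinj : Function.Injective L := by
    rw [← LinearMap.ker_eq_bot, LinearMap.ker_eq_bot']
    intro v hv
    exact hΩ.nondegenerate x v (fun w => LinearMap.congr_fun hv w)
  have hsurj : Function.Surjective L :=
    (LinearMap.injective_iff_surjective_of_finrank_eq_finrank
      (Subspace.dual_finrank_eq).symm).1 hinj
  let D : Module.Dual ℝ (TangentSpace 𝓘(ℝ, E) x) :=
    (mfderiv 𝓘(ℝ, E) 𝓘(ℝ, ℝ) f x).toLinearMap
  obtain ⟨v, hv⟩ := hsurj D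
  refine ⟨v, fun w => LinearMap.congr_fun hv w, fun v' hv' => hinj ?_⟩
  rw [hv]
  exact LinearMap.ext hv'

/-- The Hamiltonian vector field `X_f` of a smooth function `f` on a symplectic manifold, defined by
`i_{X_f} Ω = df`. -/
noncomputable def IsSymplectic.hamiltonianVectorField [FiniteDimensional ℝ E] {Ω : DiffForm E M 2}
    (hΩ : IsSymplectic Ω) (f : M → ℝ) : (x : M) → TangentSpace 𝓘(ℝ, E) x :=
  fun x => (hΩ.existsUnique_hamiltonian f x).choose

theorem IsSymplectic.hamiltonianVectorField_spec [FiniteDimensional ℝ E] {Ω : DiffForm E M 2}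
    (hΩ : IsSymplectic Ω) (f : M → ℝ) (x : M) (w : TangentSpace 𝓘(ℝ, E) x) :
    Ω x ![hΩ.hamiltonianVectorField f x, w] = (mfderiv 𝓘(ℝ, E) 𝓘(ℝ, ℝ) f x w : ℝ) :=
  (hΩ.existsUnique_hamiltonian f x).choose_spec.1 w

/-- The vector field `X` on `M` is `f`-projectable with projection `Y`: `Tf ∘ X = Y ∘ f`. -/
def ProjectsTo (f : M → N) (X : (x : M) → TangentSpace 𝓘(ℝ, E) x)
    (Y : (y : N) → TangentSpace 𝓘(ℝ, F) y) : Prop :=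
  ∀ x : M, mfderiv 𝓘(ℝ, E) 𝓘(ℝ, F) f x (X x) = Y (f x)

end Forms

/-! ## Principal `ℝ`-bundles and non-autonomous Hamiltonian systems -/

section Bundles

variable {E : Type*} [NormedAddCommGroup E] [NormedSpace ℝ E]
  {F : Type*} [NormedAddCommGroup F] [NormedSpace ℝ F]
  {A : Type*} [TopologicalSpace A] [ChartedSpace E A]
  {V : Type*} [TopologicalSpace V] [ChartedSpace F V]

/-- `μ : A → V` is a smooth principal `ℝ`-bundle with principal action `ψ`: the map `ψ` is a smooth
action of `(ℝ, +)` on `A` preserving the fibres of the smooth map `μ`, and around each point of `V`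
there is a smooth local trivialization `μ ⁻¹(U) ≃ U × ℝ` that carries `ψ` to the translations of the
factor `ℝ`. -/
structure IsPrincipalRBundle (μ : A → V) (ψ : ℝ → A → A) : Prop where
  smooth_proj : ContMDiff 𝓘(ℝ, E) 𝓘(ℝ, F) ∞ μ
  smooth_action : ContMDiff (𝓘(ℝ, ℝ).prod 𝓘(ℝ, E)) 𝓘(ℝ, E) ∞ (fun p : ℝ × A => ψ p.1 p.2)
  zero_action : ∀ a : A, ψ 0 a = a
  add_action : ∀ (s t : ℝ) (a : A), ψ (s + t) a = ψ s (ψ t a)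
  proj_action : ∀ (s : ℝ) (a : A), μ (ψ s a) = μ a
  locally_trivial : ∀ v : V, ∃ e : Bundle.Trivialization ℝ μ, v ∈ e.baseSet ∧
    ContMDiffOn 𝓘(ℝ, E) (𝓘(ℝ, F).prod 𝓘(ℝ, ℝ)) ∞ e e.source ∧
    ContMDiffOn (𝓘(ℝ, F).prod 𝓘(ℝ, ℝ)) 𝓘(ℝ, E) ∞ e.toOpenPartialHomeomorph.symm e.target ∧
    ∀ (s : ℝ), ∀ a ∈ e.source, e (ψ s a) = (μ a, s + (e a).2)

/-- The infinitesimal generator `Z(a) = d/ds ψ(s, a)` at `s = 0` of an action of `ℝ`. -/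
noncomputable def infinitesimalGenerator (ψ : ℝ → A → A) : (a : A) → TangentSpace 𝓘(ℝ, E) a :=
  fun a => (mfderiv 𝓘(ℝ, ℝ) 𝓘(ℝ, E) (fun s : ℝ => ψ s a) 0 (1 : ℝ) : E)

/-- `(A, μ, Ω, h)` is a non-autonomous Hamiltonian system: `μ : A → V` is a principal `ℝ`-bundle
whose total space carries a symplectic form `Ω` preserved by the principal action `ψ`, and `h` is a
smooth section of `μ`. -/
structure IsNonautonomousHamiltonianSystem (μ : A → V) (ψ : ℝ → A → A) (Ω : DiffForm E A 2)
    (h : V → A) : Prop where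
  principal : IsPrincipalRBundle (E := E) (F := F) μ ψ
  symplectic : IsSymplectic Ω
  symplectic_action : ∀ s : ℝ, DiffForm.pullback (ψ s) Ω = Ω
  smooth_section : ContMDiff 𝓘(ℝ, F) 𝓘(ℝ, E) ∞ h
  section_spec : ∀ v : V, μ (h v) = v

theorem IsPrincipalRBundle.existsUnique_translation {μ : A → V} {ψ : ℝ → A → A}
    (hμ : IsPrincipalRBundle (E := E) (F := F) μ ψ) {a b : A} (hab : μ b = μ a) :
    ∃! s : ℝ, a = ψ s b := by
  obtain ⟨e, hv, -, -, he⟩ := hμ.locally_trivial (μ a)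
  have ha : a ∈ e.source := e.mem_source.2 hv
  have hb : b ∈ e.source := e.mem_source.2 (by rwa [hab])
  have hψ : ∀ s, ψ s b ∈ e.source := fun s => e.mem_source.2 (by rwa [hμ.proj_action, hab])
  refine ⟨(e a).2 - (e b).2, ?_, ?_⟩
  · refine e.injOn ha (hψ _) ?_
    change e a = e (ψ _ b)
    rw [he _ b hb]
    exact Prod.ext ((e.coe_fst ha).trans hab.symm) (by simp)
  · intro s hs
    have h1 := he s b hb
    rw [← hs] at h1
    rw [h1]
    simp

namespace IsNonautonomousHamiltonianSystem

variable {μ : A → V} {ψ : ℝ → A → A} {Ω : DiffForm E A 2} {h : V → A}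

/-- The function `F_h : A → ℝ` of the section `h`, characterized by `a = ψ(F_h(a), h(μ(a)))`. -/
noncomputable def sectionFunction
    (H : IsNonautonomousHamiltonianSystem (F := F) μ ψ Ω h) : A → ℝ :=
  fun a => (H.principal.existsUnique_translation (a := a) (b := h (μ a))
    (H.section_spec (μ a))).choose

theorem sectionFunction_spec (H : IsNonautonomousHamiltonianSystem (F := F) μ ψ Ω h) (a : A) :
    a = ψ (H.sectionFunction a) (h (μ a)) :=
  (H.principal.existsUnique_translation (a := a) (b := h (μ a))
    (H.section_spec (μ a))).choose_spec.1

end IsNonautonomousHamiltonianSystem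

/-- The `2`-form `ω_h = h^* Ω` on `V`. -/
noncomputable def omegaH (Ω : DiffForm E A 2) (h : V → A) : DiffForm F V 2 :=
  DiffForm.pullback h Ω

/-- The `1`-form `η_h = - h^* (i_Z Ω)` on `V`, with `Z` the infinitesimal generator of `ψ`. -/
noncomputable def etaH (ψ : ℝ → A → A) (Ω : DiffForm E A 2) (h : V → A) : DiffForm F V 1 :=
  fun v => -(DiffForm.pullback h (DiffForm.interior (infinitesimalGenerator ψ) Ω) v)

end Bundles

/-!
# Non-autonomous Hamiltonian systems induce cosymplectic structures

Everything rests on differentiating the identity `a = ψ (F_h a) (h (μ a))` along the image of `h`: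
every tangent vector `w` of `A` at `h v` is `dF_h(w) Z + Th (Tμ w)`
(`IsNonautonomousHamiltonianSystem.tangent_splitting`), where moreover `dF_h(Z) = 1` and
`dF_h ∘ Th = 0`. Let `X` be the Hamiltonian vector field of `F_h`. Since `F_h (ψ_s a) = s + F_h a`
and `Ω` is invariant, `X` is invariant under the action, hence projects to
`R v = Tμ (X (h v))`. Since `dF_h(X) = Ω(X, X) = 0`, the splitting gives `X = Th R` along `h`, so
that `ω_h(R, w) = Ω(X, Th w) = dF_h(Th w) = 0` and `η_h(R) = Ω(X, Z) = dF_h(Z) = 1`. The splitting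
and the nondegeneracy of `Ω` also show that `ω_h` and `η_h` have no common kernel, which gives the
uniqueness of `R`.

Smoothness of `F_h` is read off in local trivializations. Smoothness of `X` follows in charts from
the smoothness of the inversion of linear maps (`contDiffAt_curryLeft_inverse_apply`).

The form `ω_h` is closed because exterior derivatives commute with pullbacks
(`DiffForm.IsClosed.pullback`). For `η_h`, Cartan's formula is avoided: the pullback of `Ω` by
`(y, s) ↦ ψ (s, h y)` is a closed form on `F × ℝ` (in a chart of `V`) that does not depend on `s`,
and `η_h` is, up to sign, its contraction with `∂/∂s` on the slice `s = 0`, so that `dη_h = 0` is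
what remains of the closedness of this form evaluated on `∂/∂s`
(`extDeriv_contraction_eq_zero`).

The rest is linear algebra (`exists_finrank_eq_and_wedge_ne_zero`). A space with a `2`-form and a
`1`-form without common kernel and a Reeb vector `R` has a basis consisting of `R` and a symplectic
basis `eᵢ, fᵢ` of the kernel of the `1`-form, which gives the odd dimension. With
`b = ∑ eⁱ ⊗ fⁱ`, the top form `η ∧ ω ^ n` is the alternatization of `η ⊗ b ⊗ ⋯ ⊗ b`
(`wedge_alternatization`); on this basis only even permutations contribute, so its value there is
positive.
-/

/-! ### Wedge products as alternatizations -/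

section WedgeProducts

variable {W : Type*} [AddCommGroup W] [Module ℝ W]

/-- The product `v ↦ a (v₁, …, v_k) * b (v_{k+1}, …, v_{k+l})` of two multilinear forms. -/
noncomputable def MultilinearMap.mulForms {k l : ℕ} (a : MultilinearMap ℝ (fun _ : Fin k => W) ℝ)
    (b : MultilinearMap ℝ (fun _ : Fin l => W) ℝ) : MultilinearMap ℝ (fun _ : Fin (k + l) => W) ℝ :=
  ((LinearMap.mul' ℝ ℝ).compMultilinearMap (a.domCoprod b)).domDomCongr finSumFinEquiv

theorem MultilinearMap.mulForms_apply {k l : ℕ} (a : MultilinearMap ℝ (fun _ : Fin k => W) ℝ)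
    (b : MultilinearMap ℝ (fun _ : Fin l => W) ℝ) (v : Fin (k + l) → W) :
    a.mulForms b v = a (fun i => v (Fin.castAdd l i)) * b (fun j => v (Fin.natAdd k j)) := by
  simp [MultilinearMap.mulForms, MultilinearMap.domCoprod_apply]

/-- In the shuffle normalization, alternatization turns products into wedge products without any
numerical factor. -/
theorem wedge_alternatization {k l : ℕ} (a : MultilinearMap ℝ (fun _ : Fin k => W) ℝ)
    (b : MultilinearMap ℝ (fun _ : Fin l => W) ℝ) :
    wedge (MultilinearMap.alternatization a) (MultilinearMap.alternatization b) =
      MultilinearMap.alternatization (a.mulForms b) := by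
  ext v
  rw [wedge, ← MultilinearMap.domCoprod_alternization]
  simp only [AlternatingMap.domDomCongr_apply, LinearMap.compAlternatingMap_apply,
    MultilinearMap.alternatization_apply, map_sum]
  refine Fintype.sum_equiv finSumFinEquiv.permCongr _ _ fun σ => ?_
  simp only [Equiv.Perm.sign_permCongr]
  rw [Units.smul_def, Units.smul_def, map_zsmul]
  simp [MultilinearMap.mulForms, MultilinearMap.domCoprod_apply, MultilinearMap.domDomCongr_apply,
    Function.comp_def, Equiv.permCongr_apply]

/-- The product `v ↦ ∏ i, b (v_{2 i}, v_{2 i + 1})` of `n` copies of a bilinear form `b`. -/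
noncomputable def MultilinearMap.powForm (b : MultilinearMap ℝ (fun _ : Fin 2 => W) ℝ) :
    (n : ℕ) → MultilinearMap ℝ (fun _ : Fin (2 * n) => W) ℝ
  | 0 => haveI : IsEmpty (Fin (2 * 0)) := inferInstanceAs (IsEmpty (Fin 0))
    MultilinearMap.constOfIsEmpty ℝ (fun _ : Fin (2 * 0) => W) 1
  | n + 1 => (MultilinearMap.powForm b n).mulForms b

theorem MultilinearMap.powForm_apply (b : MultilinearMap ℝ (fun _ : Fin 2 => W) ℝ) (n : ℕ)
    (v : Fin (2 * n) → W) :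
    b.powForm n v = ∏ i : Fin n, b (fun j => v ⟨2 * i + j, by omega⟩) := by
  induction n with
  | zero => simp [MultilinearMap.powForm]
  | succ n ih =>
    rw [Fin.prod_univ_castSucc]
    exact (MultilinearMap.mulForms_apply _ _ _).trans (by rw [ih]; rfl)

theorem wedgePow_alternatization (b : MultilinearMap ℝ (fun _ : Fin 2 => W) ℝ) (n : ℕ) :
    wedgePow (MultilinearMap.alternatization b) n =
      MultilinearMap.alternatization (b.powForm n) := by
  induction n with
  | zero =>
    ext v
    have : Subsingleton (Equiv.Perm (Fin (2 * 0))) :=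
      inferInstanceAs (Subsingleton (Equiv.Perm (Fin 0)))
    rw [MultilinearMap.alternatization_apply, Fintype.sum_subsingleton _ 1]
    simp [wedgePow, MultilinearMap.powForm]
  | succ n ih => rw [wedgePow, ih, wedge_alternatization]; rfl

/-- The arguments of `η ⊗ b ⊗ ⋯ ⊗ b`: position `0` belongs to the `1`-form `η`, and position
`1 + 2 i + j` is the `j`-th argument of the `i`-th factor `b`. -/
def pairingIndexEquiv (n : ℕ) : Fin 1 ⊕ Fin n × Fin 2 ≃ Fin (1 + 2 * n) :=
  ((Equiv.refl _).sumCongr (finProdFinEquiv.trans (finCongr (mul_comm n 2)))).trans finSumFinEquiv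

/-- The value of `η ∧ (Alt b) ^ n` as a sum over all permutations of the arguments. -/
theorem wedge_wedgePow_alternatization_apply (η : W [⋀^Fin 1]→ₗ[ℝ] ℝ)
    (b : MultilinearMap ℝ (fun _ : Fin 2 => W) ℝ) (n : ℕ) (g : Fin 1 ⊕ Fin n × Fin 2 → W) :
    wedge η (wedgePow (MultilinearMap.alternatization b) n) (g ∘ (pairingIndexEquiv n).symm) =
      ∑ σ : Equiv.Perm (Fin 1 ⊕ Fin n × Fin 2), ((Equiv.Perm.sign σ : ℤ) : ℝ) *
        (η (fun _ => g (σ (Sum.inl 0))) * ∏ i : Fin n, b fun j => g (σ (Sum.inr (i, j)))) := by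
  have hη : η = MultilinearMap.alternatization (η : MultilinearMap ℝ (fun _ : Fin 1 => W) ℝ) := by
    rw [AlternatingMap.coe_alternatization]; simp
  rw [wedgePow_alternatization, hη, wedge_alternatization, ← hη,
    MultilinearMap.alternatization_apply]
  refine (Fintype.sum_equiv (pairingIndexEquiv n).permCongr _ _ fun σ => ?_).symm
  rw [Equiv.Perm.sign_permCongr, MultilinearMap.domDomCongr_apply, MultilinearMap.mulForms_apply,
    MultilinearMap.powForm_apply, Units.smul_def, zsmul_eq_mul]
  have h1 : ∀ i : Fin 1, (pairingIndexEquiv n).symm (Fin.castAdd (2 * n) i) = Sum.inl 0 := by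
    intro i
    rw [Equiv.symm_apply_eq, Subsingleton.elim i 0]
    rfl
  have h2 : ∀ (i : Fin n) (j : Fin 2), (pairingIndexEquiv n).symm
      (Fin.natAdd 1 ⟨2 * i + j, by omega⟩) = Sum.inr (i, j) := by
    intro i j
    rw [Equiv.symm_apply_eq]
    ext
    simp [pairingIndexEquiv, add_comm]
  congr 2
  · simp [Equiv.permCongr_apply, h1]
  · exact Finset.prod_congr rfl fun i _ => by
      simp only [Function.comp_apply, Equiv.permCongr_apply, h2, Equiv.symm_apply_apply]

end WedgeProducts

/-! ### Cosymplectic vector spaces -/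

section CosymplecticLinearAlgebra

variable {W : Type*} [AddCommGroup W] [Module ℝ W]

/-- The bilinear map underlying an alternating `2`-form. -/
noncomputable def AlternatingMap.toBilin (α : W [⋀^Fin 2]→ₗ[ℝ] ℝ) : W →ₗ[ℝ] W →ₗ[ℝ] ℝ :=
  have e0 : ∀ v w u : W, Function.update ![v, w] 0 u = ![u, w] := by
    intro v w u; funext i; fin_cases i <;> rfl
  have e1 : ∀ v w u : W, Function.update ![v, w] 1 u = ![v, u] := by
    intro v w u; funext i; fin_cases i <;> rfl
  LinearMap.mk₂ ℝ (fun v w => α ![v, w])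
    (fun v v' w => by simpa only [e0] using α.map_update_add ![v, w] 0 v v')
    (fun c v w => by simpa only [e0] using α.map_update_smul ![v, w] 0 c v)
    (fun v w w' => by simpa only [e1] using α.map_update_add ![v, w] 1 w w')
    (fun c v w => by simpa only [e1] using α.map_update_smul ![v, w] 1 c w)

theorem AlternatingMap.toBilin_apply (α : W [⋀^Fin 2]→ₗ[ℝ] ℝ) (v w : W) :
    α.toBilin v w = α ![v, w] := rfl

theorem AlternatingMap.toBilin_self (α : W [⋀^Fin 2]→ₗ[ℝ] ℝ) (v : W) : α.toBilin v v = 0 :=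
  α.map_eq_zero_of_eq ![v, v] (i := 0) (j := 1) rfl (by decide)

/-- A partial symplectic basis `e₁, …, eₙ, f₁, …, fₙ` of the kernel of `η` for the bilinear
form `B`. -/
structure IsSymplecticFamily (B : W →ₗ[ℝ] W →ₗ[ℝ] ℝ) (η : W →ₗ[ℝ] ℝ) {n : ℕ}
    (e f : Fin n → W) : Prop where
  pairing : ∀ i j, B (e i) (f j) = if i = j then 1 else 0
  left_isotropic : ∀ i j, B (e i) (e j) = 0
  right_isotropic : ∀ i j, B (f i) (f j) = 0
  left_ker : ∀ i, η (e i) = 0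
  right_ker : ∀ i, η (f i) = 0

variable {B : W →ₗ[ℝ] W →ₗ[ℝ] ℝ} {η : W →ₗ[ℝ] ℝ} {R : W} {n : ℕ} {e f : Fin n → W}

theorem IsSymplecticFamily.le_finrank [FiniteDimensional ℝ W] (h : IsSymplecticFamily B η e f) :
    n ≤ Module.finrank ℝ W := by
  have hli : LinearIndependent ℝ e := by
    rw [Fintype.linearIndependent_iff]
    intro c hc j
    have := congrArg (fun u => B u (f j)) hc
    simpa [h.pairing] using this
  simpa using hli.fintype_card_le_finrank

/-- The expansion of `u` along `R` and a partial symplectic basis, with the coefficients that `u` has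
if these vectors form a basis. -/
noncomputable def symplecticExpansion (B : W →ₗ[ℝ] W →ₗ[ℝ] ℝ) (η : W →ₗ[ℝ] ℝ) (R : W)
    (e f : Fin n → W) (u : W) : W :=
  η u • R + ∑ i, (B u (f i) • e i + B (e i) u • f i)

theorem IsSymplecticFamily.ker_expansion (h : IsSymplecticFamily B η e f) (hηR : η R = 1) (u : W) :
    η (symplecticExpansion B η R e f u) = η u := by
  simp [symplecticExpansion, hηR, h.left_ker, h.right_ker]

theorem IsSymplecticFamily.left_expansion (h : IsSymplecticFamily B η e f) (hB : ∀ v, B v v = 0)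
    (hR : B R = 0) (u : W) (j : Fin n) :
    B (e j) (symplecticExpansion B η R e f u) = B (e j) u := by
  have hR' : ∀ v, B v R = 0 := fun v => by
    rw [← LinearMap.IsAlt.neg hB, hR]; simp
  simp [symplecticExpansion, hR', h.left_isotropic, h.pairing]

theorem IsSymplecticFamily.right_expansion (h : IsSymplecticFamily B η e f) (hR : B R = 0) (u : W)
    (j : Fin n) :
    B (symplecticExpansion B η R e f u) (f j) = B u (f j) := by
  simp [symplecticExpansion, hR, h.right_isotropic, h.pairing]

/-- A partial symplectic basis that does not span together with `R` can be enlarged by a pair of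
vectors in its orthogonal complement. -/
theorem IsSymplecticFamily.exists_succ (h : IsSymplecticFamily B η e f) (hB : ∀ v, B v v = 0)
    (hR : B R = 0) (hηR : η R = 1) (hnd : ∀ v, B v = 0 → η v = 0 → v = 0) {u : W}
    (hu : u ≠ symplecticExpansion B η R e f u) :
    ∃ e' f' : Fin (n + 1) → W, IsSymplecticFamily B η e' f' := by
  have hskew : ∀ x y, B x y = - B y x := fun x y => (LinearMap.IsAlt.neg hB y x).symm
  obtain ⟨r, hr⟩ : ∃ r, r = u - symplecticExpansion B η R e f u := ⟨_, rfl⟩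
  have hηr : η r = 0 := by rw [hr, map_sub, h.ker_expansion hηR, sub_self]
  have her : ∀ i, B (e i) r = 0 := fun i => by
    rw [hr, map_sub, h.left_expansion hB hR, sub_self]
  have hrf : ∀ i, B r (f i) = 0 := fun i => by
    rw [hr, map_sub, LinearMap.sub_apply, h.right_expansion hR, sub_self]
  obtain ⟨w, hw⟩ : ∃ w, B r w ≠ 0 := by
    by_contra! hcon
    exact hu (sub_eq_zero.1 (hr.symm.trans (hnd r (LinearMap.ext hcon) hηr)))
  -- Subtracting its expansion and rescaling makes `w` a partner of `r`.
  obtain ⟨s, hs⟩ : ∃ s, s = (B r w)⁻¹ • (w - symplecticExpansion B η R e f w) := ⟨_, rfl⟩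
  have hηs : η s = 0 := by rw [hs, map_smul, map_sub, h.ker_expansion hηR]; simp
  have hes : ∀ i, B (e i) s = 0 := fun i => by
    rw [hs, map_smul, map_sub, h.left_expansion hB hR]; simp
  have hsf : ∀ i, B s (f i) = 0 := fun i => by
    rw [hs, map_smul, map_sub, LinearMap.smul_apply, LinearMap.sub_apply,
      h.right_expansion hR]
    simp
  have hrs : B r s = 1 := by
    have h0 : B r (symplecticExpansion B η R e f w) = 0 := by
      have hrR : B r R = 0 := by rw [hskew, hR]; simp
      have hre : ∀ i, B r (e i) = 0 := fun i => by rw [hskew, her, neg_zero]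
      simp [symplecticExpansion, hrR, hre, hrf]
    rw [hs, map_smul, map_sub, h0, sub_zero, smul_eq_mul, inv_mul_cancel₀ hw]
  refine ⟨Fin.cons r e, Fin.cons s f, ?_, ?_, ?_, ?_, ?_⟩
  · intro i j
    induction i using Fin.cases <;> induction j using Fin.cases <;>
      simp [hrs, hrf, hes, h.pairing, Fin.succ_ne_zero, (Fin.succ_ne_zero _).symm]
  · intro i j
    induction i using Fin.cases <;> induction j using Fin.cases <;>
      simp [hB, her, h.left_isotropic, hskew r]
  · intro i j
    induction i using Fin.cases <;> induction j using Fin.cases <;>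
      simp [hB, hsf, h.right_isotropic, hskew _ s]
  · intro i
    induction i using Fin.cases <;> simp [hηr, h.left_ker]
  · intro i
    induction i using Fin.cases <;> simp [hηs, h.right_ker]

/-- A cosymplectic vector space has a basis consisting of `R` and a symplectic basis of the kernel
of `η`. -/
theorem exists_symplecticFamily_expansion [FiniteDimensional ℝ W] (hB : ∀ v, B v v = 0)
    (hR : B R = 0) (hηR : η R = 1) (hnd : ∀ v, B v = 0 → η v = 0 → v = 0) :
    ∃ (n : ℕ) (e f : Fin n → W), IsSymplecticFamily B η e f ∧
      ∀ u, u = symplecticExpansion B η R e f u := by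
  by_contra! hcon
  have key : ∀ n : ℕ, ∃ e f : Fin n → W, IsSymplecticFamily B η e f := by
    intro n
    induction n with
    | zero => exact ⟨Fin.elim0, Fin.elim0, ⟨nofun, nofun, nofun, nofun, nofun⟩⟩
    | succ n ih =>
      obtain ⟨e, f, h⟩ := ih
      obtain ⟨u, hu⟩ := hcon n e f h
      exact h.exists_succ hB hR hηR hnd hu
  obtain ⟨e, f, h⟩ := key (Module.finrank ℝ W + 1)
  have := h.le_finrank
  omega

theorem IsSymplecticFamily.finrank_eq (h : IsSymplecticFamily B η e f)
    (hB : ∀ v, B v v = 0) (hR : B R = 0) (hηR : η R = 1)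
    (hexp : ∀ u, u = symplecticExpansion B η R e f u) :
    Module.finrank ℝ W = 2 * n + 1 := by
  let T : W →ₗ[ℝ] ℝ × (Fin n → ℝ) × (Fin n → ℝ) :=
    η.prod ((LinearMap.pi fun i => B.flip (f i)).prod (LinearMap.pi fun i => B (e i)))
  have hT : Function.Bijective T := by
    constructor
    · rw [← LinearMap.ker_eq_bot, LinearMap.ker_eq_bot']
      intro u hu
      have h1 : η u = 0 := congrArg Prod.fst hu
      have h2 : ∀ i, B u (f i) = 0 := fun i => congrFun (congrArg (fun p => p.2.1) hu) i
      have h3 : ∀ i, B (e i) u = 0 := fun i => congrFun (congrArg (fun p => p.2.2) hu) i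
      rw [hexp u]
      simp [symplecticExpansion, h1, h2, h3]
    · rintro ⟨c, x, y⟩
      have hR' : ∀ v, B v R = 0 := fun v => by
        rw [← LinearMap.IsAlt.neg hB, hR]; simp
      refine ⟨c • R + ∑ i, (x i • e i + y i • f i), ?_⟩
      ext j <;> simp [T, hηR, h.left_ker, h.right_ker, hR, hR', h.left_isotropic,
        h.right_isotropic, h.pairing]
  rw [(LinearEquiv.ofBijective T hT).finrank_eq]
  simp
  ring

/-- The top form of a cosymplectic vector space does not vanish: evaluated on `R` and a symplectic
basis, the terms of the alternatization of `η ⊗ b ⊗ ⋯ ⊗ b`, with `b = ∑ eⁱ ⊗ fⁱ`, are nonnegative,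
since only permutations of the pairs `(eᵢ, fᵢ)` contribute and these are even. -/
theorem IsSymplecticFamily.wedge_ne_zero {α : W [⋀^Fin 2]→ₗ[ℝ] ℝ} {η₁ : W [⋀^Fin 1]→ₗ[ℝ] ℝ}
    (h : IsSymplecticFamily α.toBilin η e f) (hη : ∀ v, η₁ (fun _ => v) = η v)
    (hR : α.toBilin R = 0) (hηR : η R = 1)
    (hexp : ∀ u, u = symplecticExpansion α.toBilin η R e f u) :
    wedge η₁ (wedgePow α n) ≠ 0 := by
  set B := α.toBilin with hBdef
  have hB : ∀ v, B v v = 0 := α.toBilin_self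
  have hskew : ∀ x y, B x y = - B y x := fun x y => (LinearMap.IsAlt.neg hB y x).symm
  have hR' : ∀ v, B v R = 0 := fun v => by rw [hskew, hR]; simp
  let b : MultilinearMap ℝ (fun _ : Fin 2 => W) ℝ := ∑ i : Fin n,
    (MultilinearMap.mkPiAlgebra ℝ (Fin 2) ℝ).compLinearMap ![B.flip (f i), B (e i)]
  have hb : ∀ v : Fin 2 → W, b v = ∑ i, B (v 0) (f i) * B (e i) (v 1) := by
    intro v
    simp [b, Fin.prod_univ_two]
  have halt : MultilinearMap.alternatization b = α := by
    ext v
    rw [MultilinearMap.alternatization_apply]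
    have hv : α v = B (v 0) (v 1) := by
      rw [hBdef, AlternatingMap.toBilin_apply]
      congr 1
      ext i
      fin_cases i <;> rfl
    rw [hv]
    conv_rhs => rw [hexp (v 0)]
    have hperm : (Finset.univ : Finset (Equiv.Perm (Fin 2))) = {1, Equiv.swap 0 1} := by decide
    rw [hperm, Finset.sum_pair (by decide)]
    simp only [MultilinearMap.domDomCongr_apply, hb]
    simp only [symplecticExpansion, map_add, map_smul, map_sum, hR, smul_zero, zero_add,
      LinearMap.sum_apply, LinearMap.add_apply, LinearMap.smul_apply, hskew (f _) (v 1)]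
    simp [Units.smul_def, Finset.sum_add_distrib]
    simp only [mul_comm]
  let g : Fin 1 ⊕ Fin n × Fin 2 → W :=
    Sum.elim (fun _ => R) fun p => if p.2 = 0 then e p.1 else f p.1
  have hηg : ∀ s, η (g s) = if s = Sum.inl 0 then 1 else 0 := by
    rintro (s | ⟨i, j⟩)
    · simp [g, hηR, Subsingleton.elim s 0]
    · fin_cases j <;> simp [g, h.left_ker, h.right_ker]
  have hgf : ∀ s k, B (g s) (f k) = if s = Sum.inr (k, 0) then 1 else 0 := by
    rintro (s | ⟨i, j⟩) k
    · simp [g, hR]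
    · fin_cases j <;> simp [g, h.pairing, h.right_isotropic]
  have heg : ∀ s k, B (e k) (g s) = if s = Sum.inr (k, 1) then 1 else 0 := by
    rintro (s | ⟨i, j⟩) k
    · simp [g, hR']
    · fin_cases j <;> simp [g, h.pairing, h.left_isotropic, eq_comm]
  intro hzero
  have hval := congrArg (fun β => β (g ∘ (pairingIndexEquiv n).symm)) hzero
  simp only [AlternatingMap.zero_apply] at hval
  rw [← halt, wedge_wedgePow_alternatization_apply] at hval
  simp only [hη, hηg, hb, hgf, heg] at hval
  refine (Finset.sum_pos' (fun σ _ => ?_) ⟨1, Finset.mem_univ _, ?_⟩).ne' hval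
  · by_cases h0 : σ (Sum.inl 0) = Sum.inl 0
    swap
    · simp [h0]
    by_cases hk : ∀ i, ∃ k,
        σ (Sum.inr (i, 0)) = Sum.inr (k, 0) ∧ σ (Sum.inr (i, 1)) = Sum.inr (k, 1)
    swap
    · obtain ⟨i, hi⟩ := not_forall.1 hk
      rw [Finset.prod_eq_zero (Finset.mem_univ i)]
      · simp
      · refine Finset.sum_eq_zero fun k _ => ?_
        by_cases hk0 : σ (Sum.inr (i, 0)) = Sum.inr (k, 0)
        · rw [if_neg fun hk1 => hi ⟨k, hk0, hk1⟩, mul_zero]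
        · rw [if_neg hk0, zero_mul]
    -- A nonzero term comes from a permutation `τ` of the pairs, so `σ` is even.
    choose τ hτ0 hτ1 using hk
    have hτ : Function.Bijective τ := by
      refine Finite.injective_iff_bijective.1 fun i j hij => ?_
      have := σ.injective
        ((hτ0 i).trans ((congrArg (fun k => Sum.inr (k, 0)) hij).trans (hτ0 j).symm))
      simpa using this
    have hσ : σ = Equiv.Perm.sumCongr 1
        (Equiv.prodCongrLeft fun _ : Fin 2 => Equiv.ofBijective τ hτ) := by
      ext1 s
      rcases s with s | ⟨i, j⟩
      · rw [Subsingleton.elim s 0, h0]; rfl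
      · fin_cases j
        · exact hτ0 i
        · exact hτ1 i
    have hsign : Equiv.Perm.sign σ = 1 := by
      rw [hσ, Equiv.Perm.sign_sumCongr, Equiv.Perm.sign_prodCongrLeft]
      simp [← sq, Int.units_sq]
    rw [hsign]
    refine mul_nonneg (by simp) (mul_nonneg (by simp [h0]) ?_)
    refine Finset.prod_nonneg fun i _ => Finset.sum_nonneg fun k _ => mul_nonneg ?_ ?_ <;>
      split_ifs <;> norm_num
  · simp

/-- A cosymplectic vector space has odd dimension `2 n + 1`, and its top form does not vanish. -/
theorem exists_finrank_eq_and_wedge_ne_zero [FiniteDimensional ℝ W] (α : W [⋀^Fin 2]→ₗ[ℝ] ℝ)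
    (η₁ : W [⋀^Fin 1]→ₗ[ℝ] ℝ) (R : W) (hR : ∀ w, α ![R, w] = 0) (hηR : η₁ ![R] = 1)
    (hnd : ∀ v, (∀ w, α ![v, w] = 0) → η₁ ![v] = 0 → v = 0) :
    ∃ n : ℕ, Module.finrank ℝ W = 2 * n + 1 ∧ wedge η₁ (wedgePow α n) ≠ 0 := by
  let η : W →ₗ[ℝ] ℝ := (AlternatingMap.ofSubsingleton ℝ W ℝ (0 : Fin 1)).symm η₁
  have hη : ∀ v, η₁ (fun _ => v) = η v := fun v => rfl
  have hη' : ∀ v, η₁ ![v] = η v := fun v => congrArg η₁ (funext fun i => by fin_cases i; rfl)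
  have hR' : α.toBilin R = 0 := LinearMap.ext hR
  have hηR' : η R = 1 := (hη' R).symm.trans hηR
  obtain ⟨n, e, f, h, hexp⟩ := exists_symplecticFamily_expansion α.toBilin_self hR' hηR'
    fun v hv hv' => hnd v (fun w => LinearMap.congr_fun hv w) ((hη' v).trans hv')
  exact ⟨n, h.finrank_eq α.toBilin_self hR' hηR' hexp, h.wedge_ne_zero hη hR' hηR' hexp⟩

end CosymplecticLinearAlgebra

/-! ### Smoothness of fields of alternating forms on vector spaces -/

section SmoothForms

variable {E : Type*} [NormedAddCommGroup E] [NormedSpace ℝ E]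
  {G : Type*} [NormedAddCommGroup G] [NormedSpace ℝ G]
  {X : Type*} [NormedAddCommGroup X] [NormedSpace ℝ X]

theorem ContDiffAt.continuousAlternatingMap_apply {k : ℕ} {α : X → E [⋀^Fin k]→L[ℝ] ℝ}
    {w : X → Fin k → E} {x : X} (hα : ContDiffAt ℝ ∞ α x) (hw : ContDiffAt ℝ ∞ w x) :
    ContDiffAt ℝ ∞ (fun z => α z (w z)) x := by
  let T : (E [⋀^Fin k]→L[ℝ] ℝ) →L[ℝ] ContinuousMultilinearMap ℝ (fun _ : Fin k => E) ℝ :=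
    ContinuousAlternatingMap.toContinuousMultilinearMapCLM ℝ
  have hT : ContDiffAt ℝ ∞ (fun p : (E [⋀^Fin k]→L[ℝ] ℝ) × (Fin k → E) => T p.1 p.2)
      (α x, w x) := T.analyticAt_uncurry_of_multilinear.contDiffAt
  exact hT.comp x (hα.prodMk hw)

/-- A field of alternating forms on a finite-dimensional space is smooth if its values on all
constant vectors are. -/
theorem contDiffAt_continuousAlternatingMap_of_apply [FiniteDimensional ℝ E] {k : ℕ}
    {α : X → E [⋀^Fin k]→L[ℝ] ℝ} {x : X}
    (h : ∀ v : Fin k → E, ContDiffAt ℝ ∞ (fun z => α z v) x) : ContDiffAt ℝ ∞ α x := by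
  let b := Module.finBasis ℝ E
  let T : (E [⋀^Fin k]→L[ℝ] ℝ) →ₗ[ℝ] ((Fin k → Fin (Module.finrank ℝ E)) → ℝ) :=
    { toFun := fun β s => β fun i => b (s i)
      map_add' := fun _ _ => rfl
      map_smul' := fun _ _ => rfl }
  have hT : LinearMap.ker T = ⊥ := by
    rw [LinearMap.ker_eq_bot]
    intro β γ hβγ
    have : (β.toMultilinearMap : MultilinearMap ℝ (fun _ : Fin k => E) ℝ) = γ.toMultilinearMap :=
      Module.Basis.ext_multilinear (fun _ => b) fun s => congrFun hβγ s
    ext v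
    exact congrArg (fun m => m v) this
  obtain ⟨L, hL⟩ := T.exists_leftInverse_of_injective hT
  have hα : α = fun z => L.toContinuousLinearMap (T (α z)) := by
    funext z
    exact (LinearMap.congr_fun hL (α z)).symm
  rw [hα]
  exact L.toContinuousLinearMap.contDiff.contDiffAt.comp x (contDiffAt_pi.2 fun s => h _)

theorem ContDiffAt.continuousAlternatingMap_compContinuousLinearMap [FiniteDimensional ℝ G]
    {k : ℕ} {α : X → E [⋀^Fin k]→L[ℝ] ℝ} {L : X → G →L[ℝ] E} {x : X} (hα : ContDiffAt ℝ ∞ α x)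
    (hL : ContDiffAt ℝ ∞ L x) :
    ContDiffAt ℝ ∞ (fun z => (α z).compContinuousLinearMap (L z)) x :=
  contDiffAt_continuousAlternatingMap_of_apply fun _ =>
    hα.continuousAlternatingMap_apply (contDiffAt_pi.2 fun _ => hL.clm_apply contDiffAt_const)

end SmoothForms

/-! ### Pullbacks of forms -/

namespace DiffForm

open Filter Topology

variable {E : Type*} [NormedAddCommGroup E] [NormedSpace ℝ E]
  {F : Type*} [NormedAddCommGroup F] [NormedSpace ℝ F]
  {G : Type*} [NormedAddCommGroup G] [NormedSpace ℝ G]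
  {M : Type*} [TopologicalSpace M] [ChartedSpace E M]
  {N : Type*} [TopologicalSpace N] [ChartedSpace F N]
  {P : Type*} [TopologicalSpace P] [ChartedSpace G P] {k : ℕ}

theorem pullback_apply (f : M → N) (α : DiffForm F N k) (x : M)
    (v : Fin k → TangentSpace 𝓘(ℝ, E) x) :
    pullback f α x v = α (f x) fun i => mfderiv 𝓘(ℝ, E) 𝓘(ℝ, F) f x (v i) := rfl

/-- Pullbacks at `x` depend only on the germ of the map at `x`. -/
theorem pullback_congr {f g : M → N} (α : DiffForm F N k) {x : M} (h : f =ᶠ[𝓝 x] g) :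
    pullback (E := E) f α x = pullback g α x := by
  have key : ∀ (y z : N) (_ : y = z) (u : Fin k → F), α y u = α z u := by
    rintro y z rfl u
    rfl
  have h1 : (mfderiv 𝓘(ℝ, E) 𝓘(ℝ, F) f x : E →L[ℝ] F) = mfderiv 𝓘(ℝ, E) 𝓘(ℝ, F) g x :=
    h.mfderiv_eq
  ext v
  exact (key _ _ h.self_of_nhds _).trans
    (congrArg (fun L : E →L[ℝ] F => α (g x) fun i => L (v i)) h1)

theorem pullback_comp {f : M → N} {g : N → P} (α : DiffForm G P k) {x : M}
    (hg : MDifferentiableAt 𝓘(ℝ, F) 𝓘(ℝ, G) g (f x))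
    (hf : MDifferentiableAt 𝓘(ℝ, E) 𝓘(ℝ, F) f x) :
    pullback (E := E) (g ∘ f) α x = pullback f (pullback (E := F) g α) x := by
  ext v
  rw [pullback_apply, pullback_apply, pullback_apply, mfderiv_comp x hg hf]
  rfl

/-- The pullback of a form to a vector space, as a function to a fixed space of alternating maps. -/
noncomputable def flatPullback (f : E → N) (α : DiffForm F N k) : E → E [⋀^Fin k]→L[ℝ] ℝ :=
  fun z => pullback f α z

/-- Near a point of a vector space `E`, the pullback of a form by `f : E → N` is the pullback of
a chart expression of the form by the chart expression of `f`. -/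
theorem flatPullback_eventuallyEq_inChart [IsManifold 𝓘(ℝ, F) ∞ N] (α : DiffForm F N k)
    (x₀ : N) {f : E → N} {y : E}
    (hf : ContMDiffAt 𝓘(ℝ, E) 𝓘(ℝ, F) ∞ f y) (hy : f y ∈ (chartAt F x₀).source) :
    flatPullback f α =ᶠ[𝓝 y]
      fun z => (inChart α x₀ (chartAt F x₀ (f z))).compContinuousLinearMap
        (fderiv ℝ (chartAt F x₀ ∘ f) z) := by
  have h1 : ∀ᶠ z in 𝓝 y, f z ∈ (chartAt F x₀).source :=
    hf.continuousAt.eventually ((chartAt F x₀).open_source.mem_nhds hy)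
  have h2 : ∀ᶠ z in 𝓝 y, ContMDiffAt 𝓘(ℝ, E) 𝓘(ℝ, F) 1 f z :=
    (contMDiffAt_iff_contMDiffAt_nhds (by simp)).1 (hf.of_le (by simp))
  filter_upwards [h1.eventually_nhds, h2] with z hz hdz
  have hz' := hz.self_of_nhds
  have hc : MDifferentiableAt 𝓘(ℝ, F) 𝓘(ℝ, F) (chartAt F x₀) (f z) :=
    mdifferentiableAt_atlas (chart_mem_atlas F x₀) hz'
  have hs : MDifferentiableAt 𝓘(ℝ, F) 𝓘(ℝ, F) (chartAt F x₀).symm (chartAt F x₀ (f z)) :=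
    mdifferentiableAt_atlas_symm (chart_mem_atlas F x₀) ((chartAt F x₀).map_source hz')
  have hfz : MDifferentiableAt 𝓘(ℝ, E) 𝓘(ℝ, F) f z := hdz.mdifferentiableAt (by simp)
  have heq : f =ᶠ[𝓝 z] (chartAt F x₀).symm ∘ (chartAt F x₀ ∘ f) :=
    hz.mono fun w hw => ((chartAt F x₀).left_inv hw).symm
  have h3 := (pullback_congr α heq).trans
    (pullback_comp (f := chartAt F x₀ ∘ f) α hs (hc.comp z hfz))
  ext v
  refine (congrArg (fun β => β v) h3).trans ?_
  rw [← mfderiv_eq_fderiv]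
  rfl

theorem contDiffAt_chartAt_comp [IsManifold 𝓘(ℝ, F) ∞ N] (x₀ : N) {f : E → N} {y : E}
    (hf : ContMDiffAt 𝓘(ℝ, E) 𝓘(ℝ, F) ∞ f y) (hy : f y ∈ (chartAt F x₀).source) :
    ContDiffAt ℝ ∞ (chartAt F x₀ ∘ f) y := by
  rw [← contMDiffAt_iff_contDiffAt]
  exact ((contMDiffOn_chart (x := x₀)).contMDiffAt
    ((chartAt F x₀).open_source.mem_nhds hy)).comp y hf

theorem IsSmooth.contDiffAt_inChart {α : DiffForm F N k} (hα : α.IsSmooth) {x₀ x : N}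
    (hx : x ∈ (chartAt F x₀).source) : ContDiffAt ℝ ∞ (inChart α x₀) (chartAt F x₀ x) :=
  (hα x₀).contDiffAt ((chartAt F x₀).open_target.mem_nhds ((chartAt F x₀).map_source hx))

theorem IsSmooth.contDiffAt_flatPullback [IsManifold 𝓘(ℝ, F) ∞ N] [FiniteDimensional ℝ E]
    {α : DiffForm F N k} (hα : α.IsSmooth) {f : E → N} {y : E} (hf : ContMDiffAt 𝓘(ℝ, E) 𝓘(ℝ, F) ∞ f y) :
    ContDiffAt ℝ ∞ (flatPullback f α) y := by
  have hy := mem_chart_source F (f y)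
  have hφ := contDiffAt_chartAt_comp (f y) hf hy
  refine ContDiffAt.congr_of_eventuallyEq ?_ (flatPullback_eventuallyEq_inChart α (f y) hf hy)
  exact ((hα.contDiffAt_inChart hy).comp y hφ).continuousAlternatingMap_compContinuousLinearMap
    (hφ.fderiv_right (by simp))

/-- A closed form pulls back to a closed form on a vector space. -/
theorem IsClosed.extDeriv_flatPullback [IsManifold 𝓘(ℝ, F) ∞ N] {α : DiffForm F N k}
    (hα : α.IsSmooth) (hcl : α.IsClosed) {f : E → N} {y : E} (hf : ContMDiffAt 𝓘(ℝ, E) 𝓘(ℝ, F) ∞ f y) :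
    extDeriv (flatPullback f α) y = 0 := by
  have hy := mem_chart_source F (f y)
  have hφ := contDiffAt_chartAt_comp (f y) hf hy
  rw [(flatPullback_eventuallyEq_inChart α (f y) hf hy).extDeriv_eq]
  refine (_root_.extDeriv_pullback (f := chartAt F (f y) ∘ f) (r := ∞)
    (show DifferentiableAt ℝ (inChart α (f y)) ((chartAt F (f y) ∘ f) y) from
      (hα.contDiffAt_inChart hy).differentiableAt (by simp)) hφ (by
        rw [minSmoothness_of_isRCLikeNormedField]
        exact WithTop.coe_le_coe.2 (le_top : (2 : ℕ∞) ≤ ⊤))).trans ?_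
  have h0 : extDeriv (inChart α (f y)) (chartAt F (f y) (f y)) = 0 := by
    ext v
    choose w hw using fun i =>
      (mdifferentiable_chart (I := 𝓘(ℝ, F)) (f y)).mfderiv_surjective hy (v i)
    have h1 := congrArg (fun β => β w) (hcl (f y))
    refine Eq.trans ?_ h1
    exact congrArg (extDeriv (inChart α (f y)) (chartAt F (f y) (f y)))
      (funext fun i => (hw i).symm)
  rw [Function.comp_apply, h0]
  ext v
  simp

/-- The chart expression of a pullback is a pullback to the model space. -/
theorem inChart_pullback [IsManifold 𝓘(ℝ, E) ∞ M] (α : DiffForm F N k) {f : M → N}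
    (hf : ContMDiff 𝓘(ℝ, E) 𝓘(ℝ, F) ∞ f) (x₀ : M) {y : E} (hy : y ∈ (chartAt E x₀).target) :
    inChart (pullback f α) x₀ y = flatPullback (f ∘ (chartAt E x₀).symm) α y := by
  have hs : MDifferentiableAt 𝓘(ℝ, E) 𝓘(ℝ, E) (chartAt E x₀).symm y :=
    mdifferentiableAt_atlas_symm (chart_mem_atlas E x₀) hy
  exact (pullback_comp α (hf.mdifferentiable (by simp) _) hs).symm

theorem contMDiffAt_comp_chartAt_symm [IsManifold 𝓘(ℝ, E) ∞ M] {f : M → N}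
    (hf : ContMDiff 𝓘(ℝ, E) 𝓘(ℝ, F) ∞ f) (x₀ : M) {y : E} (hy : y ∈ (chartAt E x₀).target) :
    ContMDiffAt 𝓘(ℝ, E) 𝓘(ℝ, F) ∞ (f ∘ (chartAt E x₀).symm) y :=
  hf.contMDiffAt.comp y ((contMDiffOn_chart_symm (x := x₀)).contMDiffAt
    ((chartAt E x₀).open_target.mem_nhds hy))

theorem IsSmooth.pullback [FiniteDimensional ℝ E] [IsManifold 𝓘(ℝ, E) ∞ M]
    [IsManifold 𝓘(ℝ, F) ∞ N] {α : DiffForm F N k} (hα : α.IsSmooth) {f : M → N}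
    (hf : ContMDiff 𝓘(ℝ, E) 𝓘(ℝ, F) ∞ f) : (pullback (E := E) f α).IsSmooth := fun x₀ _ hy =>
  ((hα.contDiffAt_flatPullback (contMDiffAt_comp_chartAt_symm hf x₀ hy)).congr_of_eventuallyEq
    (Filter.eventuallyEq_of_mem ((chartAt E x₀).open_target.mem_nhds hy) fun _ hz =>
      inChart_pullback α hf x₀ hz)).contDiffWithinAt

/-- It suffices to check closedness on chart expressions. -/
theorem isClosed_of_extDeriv_inChart {α : DiffForm E M k}
    (h : ∀ x : M, extDeriv (inChart α x) (chartAt E x x) = 0) : α.IsClosed := fun x => by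
  ext v
  exact congrArg (fun β => β fun i => mfderiv 𝓘(ℝ, E) 𝓘(ℝ, E) (chartAt E x) x (v i)) (h x)

theorem IsClosed.pullback [IsManifold 𝓘(ℝ, E) ∞ M]
    [IsManifold 𝓘(ℝ, F) ∞ N] {α : DiffForm F N k} (hcl : α.IsClosed) (hα : α.IsSmooth) {f : M → N}
    (hf : ContMDiff 𝓘(ℝ, E) 𝓘(ℝ, F) ∞ f) : (pullback (E := E) f α).IsClosed :=
  isClosed_of_extDeriv_inChart fun x₀ => by
    have hy := (chartAt E x₀).map_source (mem_chart_source E x₀)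
    rw [(Filter.eventuallyEq_of_mem ((chartAt E x₀).open_target.mem_nhds hy) fun _ hz =>
      inChart_pullback α hf x₀ hz).extDeriv_eq]
    exact hcl.extDeriv_flatPullback hα (contMDiffAt_comp_chartAt_symm hf x₀ hy)

end DiffForm

/-! ### Contraction of an invariant closed form with a translation -/

section Contraction

open Topology

variable {F : Type*} [NormedAddCommGroup F] [NormedSpace ℝ F]

/-- If a `2`-form `β` on `F × ℝ` is closed and invariant under translations of the factor `ℝ`, then
the restriction of `i_{∂/∂s} β` to `F × {0}` is closed: in the formula for `dβ (∂/∂s, u, v)`, the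
derivative along `∂/∂s` drops out. -/
theorem extDeriv_contraction_eq_zero {β : F × ℝ → (F × ℝ) [⋀^Fin 2]→L[ℝ] ℝ} {y : F}
    (hβ : DifferentiableAt ℝ β (y, 0)) (hcl : extDeriv β (y, 0) = 0)
    (hinv : ∀ s, β (y, s) = β (y, 0)) {γ : F → F [⋀^Fin 1]→L[ℝ] ℝ}
    (hγ : DifferentiableAt ℝ γ y)
    (hγβ : ∀ᶠ z in 𝓝 y, ∀ u : Fin 1 → F, γ z u = -β (z, 0) ![(0, 1), (u 0, 0)]) :
    extDeriv γ y = 0 := by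
  ext w
  have hdir : ∀ (u v : F), fderiv ℝ (fun z => γ z ![u]) y v =
      - fderiv ℝ (fun p => β p ![(0, 1), (u, 0)]) (y, 0) (v, 0) := by
    intro u v
    have h1 : (fun z => γ z ![u]) =ᶠ[𝓝 y] fun z => -β (z, 0) ![(0, 1), (u, 0)] :=
      hγβ.mono fun z hz => hz ![u]
    have hβu : DifferentiableAt ℝ (fun p => β p ![(0, 1), (u, 0)]) (y, 0) :=
      hβ.continuousAlternatingMap_apply_const _
    have h2 : HasFDerivAt (fun z : F => (z, (0 : ℝ))) (ContinuousLinearMap.inl ℝ F ℝ) y :=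
      hasFDerivAt_prodMk_left y 0
    have h3 : HasFDerivAt (fun z => -β (z, 0) ![(0, 1), (u, 0)]) _ y :=
      (hβu.hasFDerivAt.comp y h2).fun_neg
    rw [h1.fderiv_eq, h3.fderiv]
    simp
  have hs : ∀ a : Fin 2 → F × ℝ, fderiv ℝ (fun p => β p a) (y, 0) (0, 1) = 0 := by
    intro a
    have hβa : DifferentiableAt ℝ (fun p => β p a) (y, (0 : ℝ)) :=
      hβ.continuousAlternatingMap_apply_const _
    have h2 : HasFDerivAt (fun s : ℝ => (y, s)) (ContinuousLinearMap.inr ℝ F ℝ) 0 :=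
      hasFDerivAt_prodMk_right y 0
    have h3 := (hβa.hasFDerivAt.comp (0 : ℝ) h2).fderiv
    have h4 : ((fun p => β p a) ∘ fun s : ℝ => (y, s)) = fun _ => β (y, 0) a :=
      funext fun s => congrArg (fun ε => ε a) (hinv s)
    rw [h4, fderiv_fun_const] at h3
    simpa using (congrArg (fun L => L (1 : ℝ)) h3).symm
  have h3 := congrArg (fun ε => ε ![(0, 1), (w 0, 0), (w 1, 0)]) hcl
  have r0 : Fin.removeNth 0 ![((0 : F), (1 : ℝ)), (w 0, 0), (w 1, 0)] = ![(w 0, 0), (w 1, 0)] := by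
    ext i : 1
    fin_cases i <;> rfl
  have r1 : Fin.removeNth 1 ![((0 : F), (1 : ℝ)), (w 0, 0), (w 1, 0)] = ![(0, 1), (w 1, 0)] := by
    ext i : 1
    fin_cases i <;> rfl
  have r2 : Fin.removeNth 2 ![((0 : F), (1 : ℝ)), (w 0, 0), (w 1, 0)] = ![(0, 1), (w 0, 0)] := by
    ext i : 1
    fin_cases i <;> rfl
  have r3 : Fin.removeNth 0 w = ![w 1] := by
    ext i : 1
    fin_cases i; rfl
  have r4 : Fin.removeNth 1 w = ![w 0] := by
    ext i : 1
    fin_cases i; rfl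
  rw [extDeriv_apply hβ] at h3
  replace h3 := (Fin.sum_univ_three _).symm.trans h3
  rw [r0, r1, r2] at h3
  rw [extDeriv_apply hγ, Fin.sum_univ_two, r3, r4, hdir, hdir]
  have h4 := hs ![(w 0, 0), (w 1, 0)]
  simp at h3 ⊢
  linarith

end Contraction

/-! ### Derivatives between model spaces -/

section ModelDerivative

variable {E : Type*} [NormedAddCommGroup E] [NormedSpace ℝ E]
  {F : Type*} [NormedAddCommGroup F] [NormedSpace ℝ F]
  {G : Type*} [NormedAddCommGroup G] [NormedSpace ℝ G]
  {M : Type*} [TopologicalSpace M] [ChartedSpace E M]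
  {N : Type*} [TopologicalSpace N] [ChartedSpace F N]
  {P : Type*} [TopologicalSpace P] [ChartedSpace G P]

/-- The derivative of `f : M → N` at `x` as a map between the model spaces. All tangent spaces of
`M` have the model space as underlying space, so that with fixed source and target the base points
can be rewritten. -/
noncomputable def modelDeriv (f : M → N) (x : M) : E →L[ℝ] F := mfderiv 𝓘(ℝ, E) 𝓘(ℝ, F) f x

theorem modelDeriv_comp_apply {f : M → N} {g : N → P} {x : M}
    (hg : MDifferentiableAt 𝓘(ℝ, F) 𝓘(ℝ, G) g (f x))
    (hf : MDifferentiableAt 𝓘(ℝ, E) 𝓘(ℝ, F) f x) (u : E) :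
    (modelDeriv (fun z => g (f z)) x u : G) = (modelDeriv g (f x) (modelDeriv f x u : F) : G) := by
  have h := mfderiv_comp x hg hf
  exact congrArg (fun L : E →L[ℝ] G => L u) h

theorem modelDeriv_id_apply (x : M) (u : E) : (modelDeriv (fun z : M => z) x u : E) = u := by
  exact congrArg (fun L : E →L[ℝ] E => L u) (mfderiv_id (I := 𝓘(ℝ, E)) (x := x))

theorem modelDeriv_const_apply (x : M) (y : N) (u : E) :
    (modelDeriv (fun _ : M => y) x u : F) = 0 :=
  congrArg (fun L : E →L[ℝ] F => L u)
    (mfderiv_const (I := 𝓘(ℝ, E)) (I' := 𝓘(ℝ, F)) (x := x) (c := y))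

/-- The value of a form at `x` as a form on the model space. -/
noncomputable def DiffForm.modelForm {k : ℕ} (α : DiffForm E M k) (x : M) :
    E [⋀^Fin k]→L[ℝ] ℝ := α x

/-- The value of a vector field at `x` as a vector of the model space. -/
def modelVector (X : (x : M) → TangentSpace 𝓘(ℝ, E) x) (x : M) : E := X x

theorem DiffForm.modelForm_skew (α : DiffForm E M 2) (x : M) (u w : E) :
    α.modelForm x ![u, w] = -α.modelForm x ![w, u] := by
  have h := (α.modelForm x).map_swap ![w, u] (i := 0) (j := 1) (by decide)
  refine Eq.trans (congrArg (α.modelForm x) ?_) h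
  ext i : 1
  fin_cases i <;> rfl

end ModelDerivative

/-! ### Hamiltonian vector fields -/

section Hamiltonian

open Topology Filter

variable {E : Type*} [NormedAddCommGroup E] [NormedSpace ℝ E]
  {M : Type*} [TopologicalSpace M] [ChartedSpace E M]

/-- The solution `u` of `i_u ω₂ = θ`, for a smooth `2`-form `ω₂` on a vector space that is
nondegenerate at `y` and a smooth `1`-form `θ`, depends smoothly on the point: near `y` the map
`u ↦ i_u ω₂` is invertible, and inversion of linear maps is smooth. -/
theorem contDiffAt_curryLeft_inverse_apply [FiniteDimensional ℝ E]
    {ω₂ : E → E [⋀^Fin 2]→L[ℝ] ℝ} {θ : E → E →L[ℝ] ℝ} {y : E} (hω : ContDiffAt ℝ ∞ ω₂ y)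
    (hθ : ContDiffAt ℝ ∞ θ y) (hnd : ∀ v, (∀ w, ω₂ y ![v, w] = 0) → v = 0) :
    (∀ᶠ z in 𝓝 y, ((ω₂ z).curryLeft).IsInvertible) ∧
    ContDiffAt ℝ ∞ (fun z => ((ω₂ z).curryLeft).inverse
      (ContinuousAlternatingMap.ofSubsingleton ℝ E ℝ (0 : Fin 1) (θ z))) y := by
  let ℓ := ContinuousAlternatingMap.ofSubsingletonLIE (𝕜 := ℝ) (E := E) (F := ℝ) (0 : Fin 1)
  have hfr : Module.finrank ℝ E = Module.finrank ℝ (E [⋀^Fin 1]→L[ℝ] ℝ) := by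
    rw [← ℓ.toLinearEquiv.finrank_eq, ← (LinearMap.toContinuousLinearMap (𝕜 := ℝ) (E := E)
      (F' := ℝ)).finrank_eq]
    exact Subspace.dual_finrank_eq.symm
  have : FiniteDimensional ℝ (E [⋀^Fin 1]→L[ℝ] ℝ) := ℓ.toLinearEquiv.finiteDimensional
  have hinj : Function.Injective (ω₂ y).curryLeft := by
    rw [injective_iff_map_eq_zero]
    intro v hv
    exact hnd v fun w => congrArg (fun β => β ![w]) hv
  let e : E ≃L[ℝ] (E [⋀^Fin 1]→L[ℝ] ℝ) :=
    (LinearEquiv.ofInjectiveOfFinrankEq ((ω₂ y).curryLeft : E →ₗ[ℝ] (E [⋀^Fin 1]→L[ℝ] ℝ))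
      hinj hfr).toContinuousLinearEquiv
  have he : (e : E →L[ℝ] (E [⋀^Fin 1]→L[ℝ] ℝ)) = (ω₂ y).curryLeft := by
    ext1 v; rfl
  let κ : (E [⋀^Fin 2]→L[ℝ] ℝ) →L[ℝ] (E →L[ℝ] E [⋀^Fin 1]→L[ℝ] ℝ) :=
    (ContinuousAlternatingMap.curryLeftLI (𝕜 := ℝ) (E := E) (F := ℝ) (n := 1)).toContinuousLinearMap
  have hJ : ContDiffAt ℝ ∞ (fun z => (ω₂ z).curryLeft) y := by
    have hκ : ContDiff ℝ ∞ κ := by fun_prop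
    exact hκ.contDiffAt.comp y hω
  constructor
  · exact hJ.continuousAt.eventually (by
      have h2 := ContinuousLinearEquiv.nhds e
      rw [he] at h2
      exact h2)
  · have h1 := contDiffAt_map_inverse (n := ∞) e
    rw [he] at h1
    exact (h1.comp y hJ).clm_apply (ℓ.contDiff.contDiffAt.comp y hθ)

theorem IsSymplectic.modelForm_hamiltonianVectorField [FiniteDimensional ℝ E]
    {Ω : DiffForm E M 2} (hΩ : IsSymplectic Ω) (f : M → ℝ) (x : M) (w : E) :
    Ω.modelForm x ![modelVector (hΩ.hamiltonianVectorField f) x, w] =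
      (modelDeriv (E := E) (F := ℝ) f x w : ℝ) :=
  hΩ.hamiltonianVectorField_spec f x w

theorem IsSymplectic.modelForm_nondegenerate {Ω : DiffForm E M 2} (hΩ : IsSymplectic Ω) (x : M)
    (v : E) (h : ∀ w : E, Ω.modelForm x ![v, w] = 0) : v = 0 :=
  hΩ.nondegenerate x v h

section ChartDerivative

variable {x₀ x : M} (hx : x ∈ (chartAt E x₀).source)
include hx

theorem modelDeriv_chartAt_symm_modelDeriv_chartAt [IsManifold 𝓘(ℝ, E) ∞ M] (u : E) :
    modelDeriv (E := E) (F := E) (chartAt E x₀).symm (chartAt E x₀ x)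
      (modelDeriv (E := E) (F := E) (chartAt E x₀) x u) = u :=
  congrArg (fun L : E →L[ℝ] E => L u)
    ((mdifferentiable_chart (I := 𝓘(ℝ, E)) x₀).symm_comp_deriv hx)

theorem modelDeriv_chartAt_modelDeriv_chartAt_symm [IsManifold 𝓘(ℝ, E) ∞ M] (u : E) :
    modelDeriv (E := E) (F := E) (chartAt E x₀) x
      (modelDeriv (E := E) (F := E) (chartAt E x₀).symm (chartAt E x₀ x) u) = u := by
  have h := (mdifferentiable_chart (I := 𝓘(ℝ, E)) x₀).comp_symm_deriv
    ((chartAt E x₀).map_source hx)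
  have h' := congrArg (fun L : E →L[ℝ] E => L u) h
  have h3 : modelDeriv (E := E) (F := E) (chartAt E x₀) ((chartAt E x₀).symm (chartAt E x₀ x))
      (modelDeriv (E := E) (F := E) (chartAt E x₀).symm (chartAt E x₀ x) u) = u := h'
  rwa [(chartAt E x₀).left_inv hx] at h3

theorem DiffForm.inChart_apply_pair (Ω : DiffForm E M 2) (u w : E) :
    Ω.inChart x₀ (chartAt E x₀ x) ![u, w] = Ω.modelForm x
      ![modelDeriv (E := E) (F := E) (chartAt E x₀).symm (chartAt E x₀ x) u,
        modelDeriv (E := E) (F := E) (chartAt E x₀).symm (chartAt E x₀ x) w] := by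
  have h : Ω.inChart x₀ (chartAt E x₀ x) ![u, w] =
      Ω.modelForm ((chartAt E x₀).symm (chartAt E x₀ x)) fun i =>
        modelDeriv (E := E) (F := E) (chartAt E x₀).symm (chartAt E x₀ x) (![u, w] i) := rfl
  rw [h, (chartAt E x₀).left_inv hx]
  congr 1
  ext i : 1
  fin_cases i <;> rfl

end ChartDerivative

theorem IsSymplectic.isSmoothVectorField_hamiltonianVectorField [FiniteDimensional ℝ E]
    [IsManifold 𝓘(ℝ, E) ∞ M] {Ω : DiffForm E M 2} (hΩ : IsSymplectic Ω) {f : M → ℝ}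
    (hf : ContMDiff 𝓘(ℝ, E) 𝓘(ℝ, ℝ) ∞ f) : IsSmoothVectorField (hΩ.hamiltonianVectorField f) := by
  intro x₀
  have hx₀ : x₀ ∈ (chartAt E x₀).source := mem_chart_source E x₀
  have hcd : (chartAt E x₀).MDifferentiable 𝓘(ℝ, E) 𝓘(ℝ, E) := mdifferentiable_chart x₀
  have hinvt : ∀ x ∈ (chartAt E x₀).source,
      (mfderiv 𝓘(ℝ, E) 𝓘(ℝ, E) (chartAt E x₀) x).IsInvertible := fun x hx => ⟨hcd.mfderiv hx, rfl⟩
  have hfc : ContDiffAt ℝ ∞ (f ∘ (chartAt E x₀).symm) (chartAt E x₀ x₀) := by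
    rw [← contMDiffAt_iff_contDiffAt]
    exact DiffForm.contMDiffAt_comp_chartAt_symm hf x₀ ((chartAt E x₀).map_source hx₀)
  -- The chart expression of the equation `i_X Ω = df` at a point of the chart domain.
  have hkey : ∀ x ∈ (chartAt E x₀).source, ∀ w : E, DiffForm.inChart Ω x₀ (chartAt E x₀ x)
      ![modelDeriv (E := E) (F := E) (chartAt E x₀) x
        (modelVector (hΩ.hamiltonianVectorField f) x), w] =
      fderiv ℝ (f ∘ (chartAt E x₀).symm) (chartAt E x₀ x) w := by
    intro x hx w
    rw [DiffForm.inChart_apply_pair hx, modelDeriv_chartAt_symm_modelDeriv_chartAt hx,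
      hΩ.modelForm_hamiltonianVectorField, ← mfderiv_eq_fderiv]
    have h := modelDeriv_comp_apply (x := chartAt E x₀ x) (f := (chartAt E x₀).symm) (g := f)
      (hf.mdifferentiable (by simp) _) (hcd.mdifferentiableAt_symm ((chartAt E x₀).map_source hx)) w
    rw [(chartAt E x₀).left_inv hx] at h
    exact h.symm
  obtain ⟨hI, hX⟩ := contDiffAt_curryLeft_inverse_apply (hΩ.smooth.contDiffAt_inChart hx₀)
    (hfc.fderiv_right (m := ∞) (by simp)) (by
      intro v hv
      have h0 : modelDeriv (E := E) (F := E) (chartAt E x₀).symm (chartAt E x₀ x₀) v = 0 := by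
        refine hΩ.modelForm_nondegenerate x₀ _ fun w => ?_
        have h1 := hv (modelDeriv (E := E) (F := E) (chartAt E x₀) x₀ w)
        rw [DiffForm.inChart_apply_pair hx₀, modelDeriv_chartAt_symm_modelDeriv_chartAt hx₀] at h1
        exact h1
      rw [← modelDeriv_chartAt_modelDeriv_chartAt_symm hx₀ v, h0, map_zero])
  let X' : (y : E) → TangentSpace 𝓘(ℝ, E) y := fun z =>
    ((DiffForm.inChart Ω x₀ z).curryLeft).inverse
      (ContinuousAlternatingMap.ofSubsingleton ℝ E ℝ (0 : Fin 1)
      (fderiv ℝ (f ∘ (chartAt E x₀).symm) z))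
  have hX' := (contMDiffAt_vectorSpace_iff_contDiffAt (V := X').2 hX).mpullback_vectorField_preimage
    (n := ∞) ((contMDiffOn_chart (x := x₀)).contMDiffAt ((chartAt E x₀).open_source.mem_nhds hx₀))
    (hinvt x₀ hx₀) (by simp)
  refine hX'.congr_of_eventuallyEq ?_
  filter_upwards [(chartAt E x₀).open_source.mem_nhds hx₀,
    ((chartAt E x₀).continuousAt hx₀).eventually hI] with x hx hIx
  refine congrArg (fun v => (⟨x, v⟩ : TangentBundle 𝓘(ℝ, E) M)) ?_
  have h1 : modelDeriv (E := E) (F := E) (chartAt E x₀) x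
      (modelVector (hΩ.hamiltonianVectorField f) x) =
      X' (chartAt E x₀ x) := by
    refine (hIx.inverse_apply_eq.2 ?_).symm
    ext w
    refine (hkey x hx (w 0)).symm.trans ?_
    rw [ContinuousAlternatingMap.curryLeft_apply_apply]
    congr 1
    ext i : 1
    fin_cases i <;> rfl
  exact ((hinvt x hx).inverse_apply_eq.2 h1.symm).symm

end Hamiltonian

/-! ### Geometry of the section function -/

namespace IsNonautonomousHamiltonianSystem

open Topology

variable {E : Type*} [NormedAddCommGroup E] [NormedSpace ℝ E]
  {F : Type*} [NormedAddCommGroup F] [NormedSpace ℝ F]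
  {A : Type*} [TopologicalSpace A] [ChartedSpace E A]
  {V : Type*} [TopologicalSpace V] [ChartedSpace F V]
  {μ : A → V} {ψ : ℝ → A → A} {Ω : DiffForm E A 2} {h : V → A}

theorem modelVector_infinitesimalGenerator (a : A) :
    modelVector (infinitesimalGenerator (E := E) ψ) a =
      (modelDeriv (E := ℝ) (F := E) (fun s : ℝ => ψ s a) 0 (1 : ℝ)) := rfl

theorem omegaH_modelForm (v : V) (u w : F) : (omegaH Ω h : DiffForm F V 2).modelForm v ![u, w] =
    Ω.modelForm (h v) ![(modelDeriv h v u : E), (modelDeriv h v w : E)] := by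
  refine (DiffForm.pullback_apply h Ω v ![u, w]).trans ?_
  refine congrArg (Ω.modelForm (h v)) ?_
  ext i : 1
  fin_cases i <;> rfl

theorem etaH_modelForm (v : V) (u : F) : (etaH ψ Ω h : DiffForm F V 1).modelForm v ![u] =
    -Ω.modelForm (h v)
      ![modelVector (infinitesimalGenerator (E := E) ψ) (h v), (modelDeriv h v u : E)] := by
  refine congrArg Neg.neg ?_
  refine congrArg (Ω.modelForm (h v)) ?_
  ext i : 1
  fin_cases i <;> rfl


variable (H : IsNonautonomousHamiltonianSystem (F := F) μ ψ Ω h)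
include H

theorem sectionFunction_eq {a : A} {s : ℝ} (hs : a = ψ s (h (μ a))) : H.sectionFunction a = s :=
  (H.principal.existsUnique_translation (H.section_spec (μ a))).unique
    (H.sectionFunction_spec a) hs

theorem sectionFunction_action (s : ℝ) (a : A) :
    H.sectionFunction (ψ s a) = s + H.sectionFunction a := by
  apply H.sectionFunction_eq
  rw [H.principal.proj_action, H.principal.add_action, ← H.sectionFunction_spec]

theorem sectionFunction_section (v : V) : H.sectionFunction (h v) = 0 := by
  apply H.sectionFunction_eq
  rw [H.section_spec, H.principal.zero_action]

theorem sectionFunction_action_section (s : ℝ) (v : V) : H.sectionFunction (ψ s (h v)) = s := by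
  rw [H.sectionFunction_action, H.sectionFunction_section, add_zero]

theorem contMDiff_action (s : ℝ) : ContMDiff 𝓘(ℝ, E) 𝓘(ℝ, E) ∞ (ψ s) :=
  H.principal.smooth_action.comp (contMDiff_const.prodMk contMDiff_id)

theorem contMDiff_orbit (a : A) : ContMDiff 𝓘(ℝ, ℝ) 𝓘(ℝ, E) ∞ (fun s => ψ s a) :=
  H.principal.smooth_action.comp (contMDiff_id.prodMk contMDiff_const)

/-- The section function is smooth: in a local trivialization it is the difference of the fibre
coordinates of `a` and `h (μ a)`. -/
theorem contMDiff_sectionFunction : ContMDiff 𝓘(ℝ, E) 𝓘(ℝ, ℝ) ∞ H.sectionFunction := by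
  intro a
  obtain ⟨e, hv, he, -, heψ⟩ := H.principal.locally_trivial (μ a)
  have hmem : ∀ b : A, μ b ∈ e.baseSet → h (μ b) ∈ e.source := fun b hb =>
    e.mem_source.2 (by rwa [H.section_spec])
  have hF : ∀ b ∈ e.source, H.sectionFunction b = (e b).2 - (e (h (μ b))).2 := by
    intro b hb
    have h1 := heψ (H.sectionFunction b) _ (hmem b (e.mem_source.1 hb))
    rw [← H.sectionFunction_spec] at h1
    rw [h1]
    simp
  have ha : a ∈ e.source := e.mem_source.2 hv
  have hhμ : ContMDiff 𝓘(ℝ, E) 𝓘(ℝ, E) ∞ (fun b => h (μ b)) :=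
    H.smooth_section.comp H.principal.smooth_proj
  have h1 : ContMDiffAt 𝓘(ℝ, E) 𝓘(ℝ, ℝ) ∞ (fun b => (e b).2) a :=
    contMDiffAt_snd.comp a (he.contMDiffAt (e.open_source.mem_nhds ha))
  have h2 : ContMDiffAt 𝓘(ℝ, E) 𝓘(ℝ, ℝ) ∞ (fun b => (e (h (μ b))).2) a :=
    contMDiffAt_snd.comp a
      ((he.contMDiffAt (e.open_source.mem_nhds (hmem a hv))).comp a hhμ.contMDiffAt)
  refine (h1.sub h2).congr_of_eventuallyEq ?_
  filter_upwards [e.open_source.mem_nhds ha] with b hb using hF b hb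

theorem mdifferentiableAt_proj (a : A) : MDifferentiableAt 𝓘(ℝ, E) 𝓘(ℝ, F) μ a :=
  H.principal.smooth_proj.mdifferentiable (by simp) a

theorem mdifferentiableAt_section (v : V) : MDifferentiableAt 𝓘(ℝ, F) 𝓘(ℝ, E) h v :=
  H.smooth_section.mdifferentiable (by simp) v

theorem mdifferentiableAt_action (s : ℝ) (a : A) :
    MDifferentiableAt 𝓘(ℝ, E) 𝓘(ℝ, E) (ψ s) a :=
  (H.contMDiff_action s).mdifferentiable (by simp) a

theorem mdifferentiableAt_orbit (a : A) (s : ℝ) :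
    MDifferentiableAt 𝓘(ℝ, ℝ) 𝓘(ℝ, E) (fun s => ψ s a) s :=
  (H.contMDiff_orbit a).mdifferentiable (by simp) s

theorem mdifferentiableAt_sectionFunction (a : A) :
    MDifferentiableAt 𝓘(ℝ, E) 𝓘(ℝ, ℝ) H.sectionFunction a :=
  H.contMDiff_sectionFunction.mdifferentiable (by simp) a

theorem modelDeriv_proj_section (v : V) (u : F) :
    (modelDeriv μ (h v) (modelDeriv h v u : E) : F) = u := by
  rw [← modelDeriv_comp_apply (H.mdifferentiableAt_proj _) (H.mdifferentiableAt_section v)]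
  simp only [H.section_spec]
  exact modelDeriv_id_apply v u

theorem modelDeriv_proj_action (s : ℝ) (a : A) (w : E) :
    (modelDeriv μ (ψ s a) (modelDeriv (ψ s) a w : E) : F) = modelDeriv μ a w := by
  rw [← modelDeriv_comp_apply (H.mdifferentiableAt_proj _) (H.mdifferentiableAt_action s a)]
  simp only [H.principal.proj_action]

theorem modelDeriv_sectionFunction_section (v : V) (u : F) :
    (modelDeriv H.sectionFunction (h v) (modelDeriv h v u : E) : ℝ) = 0 := by
  rw [← modelDeriv_comp_apply (H.mdifferentiableAt_sectionFunction _)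
    (H.mdifferentiableAt_section v)]
  simp only [H.sectionFunction_section]
  exact modelDeriv_const_apply v 0 u

theorem modelDeriv_sectionFunction_action (s : ℝ) (a : A) (w : E) :
    (modelDeriv H.sectionFunction (ψ s a) (modelDeriv (ψ s) a w : E) : ℝ) =
      modelDeriv H.sectionFunction a w := by
  have h1 : ContMDiff 𝓘(ℝ, ℝ) 𝓘(ℝ, ℝ) ∞ (fun t : ℝ => s + t) :=
    (contDiff_const.add contDiff_id).contMDiff
  rw [← modelDeriv_comp_apply (H.mdifferentiableAt_sectionFunction _)
    (H.mdifferentiableAt_action s a)]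
  simp only [H.sectionFunction_action]
  rw [modelDeriv_comp_apply (h1.mdifferentiable (by simp) _)
    (H.mdifferentiableAt_sectionFunction a)]
  have h2 : (modelDeriv (fun t : ℝ => s + t) (H.sectionFunction a) : ℝ →L[ℝ] ℝ) =
      ContinuousLinearMap.id ℝ ℝ := by
    rw [modelDeriv, mfderiv_eq_fderiv, fderiv_const_add]
    exact fderiv_fun_id
  rw [h2]
  rfl

theorem modelDeriv_sectionFunction_infinitesimalGenerator (v : V) :
    (modelDeriv H.sectionFunction (h v) 
      (modelVector (infinitesimalGenerator (E := E) ψ) (h v)) : ℝ) = 1 := by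
  have h1 := modelDeriv_comp_apply (x := (0 : ℝ)) (f := fun s => ψ s (h v))
    (g := H.sectionFunction) (H.mdifferentiableAt_sectionFunction _)
    (H.mdifferentiableAt_orbit (h v) 0) (1 : ℝ)
  simp only [H.sectionFunction_action_section, H.principal.zero_action] at h1
  rw [modelVector_infinitesimalGenerator, ← h1]
  exact modelDeriv_id_apply 0 1

/-- The splitting of the tangent spaces of `A` along the image of `h` into the direction of the
generator and the directions tangent to the image, obtained by differentiating
`a = ψ (F_h a) (h (μ a))`. -/
theorem tangent_splitting (v : V) (w : E) :
    w = (modelDeriv H.sectionFunction (h v) w : ℝ) •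
      modelVector (infinitesimalGenerator (E := E) ψ) (h v) +
      (modelDeriv h v (modelDeriv μ (h v) w : F) : E) := by
  have hΨ : MDifferentiableAt (𝓘(ℝ, ℝ).prod 𝓘(ℝ, E)) 𝓘(ℝ, E) (fun p : ℝ × A => ψ p.1 p.2)
      (H.sectionFunction (h v), h (μ (h v))) :=
    H.principal.smooth_action.mdifferentiable (by simp) _
  have hhμ : MDifferentiableAt 𝓘(ℝ, E) 𝓘(ℝ, E) (fun b => h (μ b)) (h v) :=
    (H.mdifferentiableAt_section _).comp (h v) (H.mdifferentiableAt_proj (h v))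
  have hg := (H.mdifferentiableAt_sectionFunction (h v)).prodMk hhμ
  have h1 := mfderiv_comp (h v) hΨ hg
  have h2 : ((fun p : ℝ × A => ψ p.1 p.2) ∘ fun b => (H.sectionFunction b, h (μ b))) = id :=
    funext fun b => (H.sectionFunction_spec b).symm
  rw [h2, mfderiv_id] at h1
  have h3 := congrArg (fun L : E →L[ℝ] E => L w) h1
  have h4 : w = modelDeriv (E := ℝ) (F := E) (fun s : ℝ => ψ s (h (μ (h v))))
      (H.sectionFunction (h v)) (modelDeriv H.sectionFunction (h v) w : ℝ) + (modelDeriv (ψ (H.sectionFunction (h v)))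
        (h (μ (h v))) (modelDeriv (fun b => h (μ b)) (h v) w : E) : E) := by
    have h5 : (mfderiv 𝓘(ℝ, E) (𝓘(ℝ, ℝ).prod 𝓘(ℝ, E))
        (fun b => (H.sectionFunction b, h (μ b))) (h v) w : ℝ × E) =
        (modelDeriv H.sectionFunction (h v) w, modelDeriv (fun b => h (μ b)) (h v) w) :=
      congrArg (fun L : E →L[ℝ] ℝ × E => L w)
        (mfderiv_prodMk (H.mdifferentiableAt_sectionFunction (h v)) hhμ)
    refine (h3.trans (mfderiv_prod_eq_add_apply hΨ)).trans ?_
    exact congrArg (fun q : ℝ × E => modelDeriv (E := ℝ) (F := E) (fun s : ℝ => ψ s (h (μ (h v))))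
      (H.sectionFunction (h v)) q.1 + (modelDeriv (ψ (H.sectionFunction (h v)))
        (h (μ (h v))) q.2 : E)) h5
  rw [H.sectionFunction_section, H.section_spec,
    modelDeriv_comp_apply (H.mdifferentiableAt_section _) (H.mdifferentiableAt_proj (h v)), H.section_spec] at h4
  have h5 : ψ 0 = fun a => a := funext H.principal.zero_action
  rw [h5, modelDeriv_id_apply] at h4
  rw [modelVector_infinitesimalGenerator, ← map_smul, smul_eq_mul, mul_one]
  exact h4

theorem modelForm_action (s : ℝ) (a : A) (u w : E) :
    Ω.modelForm (ψ s a) ![(modelDeriv (ψ s) a u : E), (modelDeriv (ψ s) a w : E)] =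
      Ω.modelForm a ![u, w] := by
  have h1 : DiffForm.pullback (ψ s) Ω a (![u, w] : Fin 2 → E) = Ω.modelForm a ![u, w] :=
    congrArg (fun α : DiffForm E A 2 => α.modelForm a ![u, w]) (H.symplectic_action s)
  rw [← h1]
  refine Eq.trans ?_ (DiffForm.pullback_apply (ψ s) Ω a _).symm
  refine congrArg (Ω.modelForm (ψ s a)) ?_
  ext i : 1
  fin_cases i <;> rfl

/-- The pair `(ω_h, η_h)` has trivial common kernel. -/
theorem eq_zero_of_omegaH_of_etaH (v : V) (u : F)
    (hω : ∀ w : F, (omegaH Ω h : DiffForm F V 2).modelForm v ![u, w] = 0)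
    (hη : (etaH ψ Ω h : DiffForm F V 1).modelForm v ![u] = 0) : u = 0 := by
  have h0 : (modelDeriv h v u : E) = 0 := by
    refine H.symplectic.modelForm_nondegenerate (h v) _ fun w => ?_
    rw [etaH_modelForm, ← DiffForm.modelForm_skew] at hη
    have h1 := hω (modelDeriv μ (h v) w)
    rw [omegaH_modelForm] at h1
    rw [H.tangent_splitting v w, DiffForm.modelForm_skew,
      ← ContinuousAlternatingMap.curryLeft_apply_apply, map_add, map_smul]
    rw [DiffForm.modelForm_skew, ← ContinuousAlternatingMap.curryLeft_apply_apply] at hη h1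
    simp only [ContinuousAlternatingMap.add_apply, ContinuousAlternatingMap.smul_apply, smul_eq_mul]
    linear_combination (modelDeriv H.sectionFunction (h v) w : ℝ) * hη + h1
  rw [← H.modelDeriv_proj_section v u, h0, map_zero]

/-! ### Smoothness and closedness of the contracted form -/

/-- The parametrization `(y, s) ↦ ψ (s, h y)` of `A`, in a chart of `V`. -/
noncomputable def flowChart (ψ : ℝ → A → A) (h : V → A) (x₀ : V) : F × ℝ → A :=
  fun p => ψ p.2 (h ((chartAt F x₀).symm p.1))

theorem contMDiffAt_flowChart [IsManifold 𝓘(ℝ, F) ∞ V] (x₀ : V) {p : F × ℝ}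
    (hp : p.1 ∈ (chartAt F x₀).target) :
    ContMDiffAt 𝓘(ℝ, F × ℝ) 𝓘(ℝ, E) ∞ (flowChart ψ h x₀) p := by
  have h1 : ContMDiffAt 𝓘(ℝ, F × ℝ) 𝓘(ℝ, E) ∞ (fun p : F × ℝ => h ((chartAt F x₀).symm p.1)) p :=
    (DiffForm.contMDiffAt_comp_chartAt_symm H.smooth_section x₀ hp).comp p
      contDiff_fst.contMDiff.contMDiffAt
  have h2 : ContMDiffAt 𝓘(ℝ, F × ℝ) 𝓘(ℝ, ℝ) ∞ (fun p : F × ℝ => p.2) p :=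
    contDiff_snd.contMDiff.contMDiffAt
  exact H.principal.smooth_action.contMDiffAt.comp p (h2.prodMk h1)

/-- Invariance of `Ω` under the action, in the parametrization by `V × ℝ`. -/
theorem flatPullback_flowChart_invariant [IsManifold 𝓘(ℝ, F) ∞ V] (x₀ : V) {y : F}
    (hy : y ∈ (chartAt F x₀).target) (s : ℝ) :
    DiffForm.flatPullback (flowChart ψ h x₀) Ω (y, s) =
      DiffForm.flatPullback (flowChart ψ h x₀) Ω (y, 0) := by
  have hd : ∀ t : ℝ, MDifferentiableAt 𝓘(ℝ, F × ℝ) 𝓘(ℝ, E) (flowChart ψ h x₀) (y, t) := fun t =>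
    (H.contMDiffAt_flowChart x₀ (p := (y, t)) hy).mdifferentiableAt (by simp)
  have hτ : MDifferentiableAt 𝓘(ℝ, F × ℝ) 𝓘(ℝ, F × ℝ) (fun p : F × ℝ => p + (0, s)) (y, 0) :=
    ((differentiable_id.add_const _) _).mdifferentiableAt
  have hτd : ∀ u : F × ℝ, (modelDeriv (fun p : F × ℝ => p + (0, s)) (y, 0) u : F × ℝ) = u := by
    intro u
    rw [modelDeriv, mfderiv_eq_fderiv, fderiv_add_const, fderiv_fun_id]
    rfl
  have heq : (fun p : F × ℝ => flowChart ψ h x₀ (p + (0, s))) =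
      fun p => ψ s (flowChart ψ h x₀ p) := by
    funext p
    simp only [flowChart, Prod.snd_add, Prod.fst_add, add_zero]
    rw [add_comm, H.principal.add_action]
  have hpt : ((y, (0 : ℝ)) : F × ℝ) + (0, s) = (y, s) := by simp
  have hder : ∀ u : F × ℝ, (modelDeriv (flowChart ψ h x₀) (y, s) u : E) =
      (modelDeriv (ψ s) (flowChart ψ h x₀ (y, 0))
        (modelDeriv (flowChart ψ h x₀) (y, (0 : ℝ)) u : E) : E) := by
    intro u
    have h1 := modelDeriv_comp_apply (f := fun p : F × ℝ => p + (0, s)) (x := (y, 0))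
      (g := flowChart ψ h x₀) (by rw [hpt]; exact hd s) hτ u
    rw [hτd, hpt, heq] at h1
    rw [← h1, modelDeriv_comp_apply (H.mdifferentiableAt_action _ _) (hd 0)]
  have hval : flowChart ψ h x₀ (y, s) = ψ s (flowChart ψ h x₀ (y, 0)) := by
    have := congrFun heq (y, 0)
    rwa [hpt] at this
  ext w
  have key : ∀ t : ℝ, DiffForm.flatPullback (flowChart ψ h x₀) Ω (y, t) w =
      Ω.modelForm (flowChart ψ h x₀ (y, t)) ![(modelDeriv (flowChart ψ h x₀) (y, t) (w 0) : E),
        (modelDeriv (flowChart ψ h x₀) (y, t) (w 1) : E)] := by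
    intro t
    refine congrArg (Ω.modelForm (flowChart ψ h x₀ (y, t))) ?_
    ext i : 1
    fin_cases i <;> rfl
  rw [key, key, hder, hder, hval, H.modelForm_action]

theorem inChart_etaH_apply [IsManifold 𝓘(ℝ, F) ∞ V] (x₀ : V) {y : F}
    (hy : y ∈ (chartAt F x₀).target) (u : Fin 1 → F) :
    (etaH ψ Ω h : DiffForm F V 1).inChart x₀ y u =
      -DiffForm.flatPullback (flowChart ψ h x₀) Ω (y, 0) ![(0, 1), (u 0, 0)] := by
  have hd : MDifferentiableAt 𝓘(ℝ, F × ℝ) 𝓘(ℝ, E) (flowChart ψ h x₀) (y, 0) :=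
    (H.contMDiffAt_flowChart x₀ (p := (y, 0)) hy).mdifferentiableAt (by simp)
  have h1 : (modelDeriv (flowChart ψ h x₀) (y, (0 : ℝ)) ((0, 1) : F × ℝ) : E) =
      modelVector (infinitesimalGenerator (E := E) ψ) (h ((chartAt F x₀).symm y)) := by
    have h2 : HasFDerivAt (fun s : ℝ => (y, s)) (ContinuousLinearMap.inr ℝ F ℝ) 0 :=
      hasFDerivAt_prodMk_right y 0
    have h3 := modelDeriv_comp_apply (f := fun s : ℝ => (y, s)) (g := flowChart ψ h x₀)
      (x := (0 : ℝ)) hd h2.differentiableAt.mdifferentiableAt (1 : ℝ)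
    have h4 : (modelDeriv (fun s : ℝ => (y, s)) (0 : ℝ) (1 : ℝ) : F × ℝ) = (0, 1) := by
      rw [modelDeriv, mfderiv_eq_fderiv, h2.fderiv]
      rfl
    rw [h4] at h3
    exact h3.symm
  have h5 : (modelDeriv (flowChart ψ h x₀) (y, (0 : ℝ)) ((u 0, 0) : F × ℝ) : E) =
      (modelDeriv h ((chartAt F x₀).symm y)
        (modelDeriv (E := F) (F := F) (chartAt F x₀).symm y (u 0)) : E) := by
    have h2 : HasFDerivAt (fun z : F => (z, (0 : ℝ))) (ContinuousLinearMap.inl ℝ F ℝ) y :=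
      hasFDerivAt_prodMk_left y 0
    have h3 := modelDeriv_comp_apply (f := fun z : F => (z, (0 : ℝ))) (g := flowChart ψ h x₀)
      (x := y) hd h2.differentiableAt.mdifferentiableAt (u 0)
    have h4 : (modelDeriv (fun z : F => (z, (0 : ℝ))) y (u 0) : F × ℝ) = (u 0, 0) := by
      rw [modelDeriv, mfderiv_eq_fderiv, h2.fderiv]
      rfl
    rw [h4] at h3
    rw [← h3, ← modelDeriv_comp_apply (H.mdifferentiableAt_section _)
      (mdifferentiableAt_atlas_symm (chart_mem_atlas F x₀) hy)]
    simp only [flowChart, H.principal.zero_action]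
  have h6 : flowChart ψ h x₀ (y, 0) = h ((chartAt F x₀).symm y) := H.principal.zero_action _
  have h7 : DiffForm.flatPullback (flowChart ψ h x₀) Ω (y, 0) ![(0, 1), (u 0, 0)] =
      Ω.modelForm (flowChart ψ h x₀ (y, 0))
        ![(modelDeriv (flowChart ψ h x₀) (y, (0 : ℝ)) ((0, 1) : F × ℝ) : E),
          (modelDeriv (flowChart ψ h x₀) (y, (0 : ℝ)) ((u 0, 0) : F × ℝ) : E)] := by
    refine congrArg (Ω.modelForm (flowChart ψ h x₀ (y, 0))) ?_
    ext i : 1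
    fin_cases i <;> rfl
  rw [h7, h1, h5, h6, ← etaH_modelForm]
  refine congrArg ((etaH ψ Ω h : DiffForm F V 1).modelForm ((chartAt F x₀).symm y)) ?_
  ext i : 1
  fin_cases i; rfl

variable [IsManifold 𝓘(ℝ, E) ∞ A] [IsManifold 𝓘(ℝ, F) ∞ V] [FiniteDimensional ℝ F]

theorem contDiffAt_inChart_etaH (x₀ : V) {y : F} (hy : y ∈ (chartAt F x₀).target) :
    ContDiffAt ℝ ∞ ((etaH ψ Ω h : DiffForm F V 1).inChart x₀) y := by
  refine contDiffAt_continuousAlternatingMap_of_apply fun u => ?_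
  have h1 : (fun z => (etaH ψ Ω h : DiffForm F V 1).inChart x₀ z u) =ᶠ[𝓝 y]
      fun z => -DiffForm.flatPullback (flowChart ψ h x₀) Ω (z, 0) ![(0, 1), (u 0, 0)] := by
    filter_upwards [(chartAt F x₀).open_target.mem_nhds hy] with z hz
    exact H.inChart_etaH_apply x₀ hz u
  refine ContDiffAt.congr_of_eventuallyEq ?_ h1
  have h2 := H.symplectic.smooth.contDiffAt_flatPullback
    (H.contMDiffAt_flowChart x₀ (p := (y, 0)) hy)
  have h3 : ContDiffAt ℝ ∞ (fun z : F => (z, (0 : ℝ))) y := contDiffAt_id.prodMk contDiffAt_const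
  exact ((h2.comp y h3).continuousAlternatingMap_apply contDiffAt_const).neg

theorem isSmooth_etaH : (etaH ψ Ω h : DiffForm F V 1).IsSmooth := fun x₀ _ hy =>
  (H.contDiffAt_inChart_etaH x₀ hy).contDiffWithinAt

theorem isClosed_etaH : (etaH ψ Ω h : DiffForm F V 1).IsClosed :=
  DiffForm.isClosed_of_extDeriv_inChart fun x₀ => by
    have hy := (chartAt F x₀).map_source (mem_chart_source F x₀)
    have hf := H.contMDiffAt_flowChart x₀ (p := (chartAt F x₀ x₀, 0)) hy
    refine extDeriv_contraction_eq_zero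
      ((H.symplectic.smooth.contDiffAt_flatPullback hf).differentiableAt (by simp))
      (H.symplectic.closed.extDeriv_flatPullback H.symplectic.smooth hf)
      (H.flatPullback_flowChart_invariant x₀ hy)
      ((H.contDiffAt_inChart_etaH x₀ hy).differentiableAt (by simp)) ?_
    filter_upwards [(chartAt F x₀).open_target.mem_nhds hy] with z hz u
    exact H.inChart_etaH_apply x₀ hz u

end IsNonautonomousHamiltonianSystem

/-! ### The Reeb vector field -/

namespace IsNonautonomousHamiltonianSystem

variable {E : Type*} [NormedAddCommGroup E] [NormedSpace ℝ E] [FiniteDimensional ℝ E]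
  {F : Type*} [NormedAddCommGroup F] [NormedSpace ℝ F]
  {A : Type*} [TopologicalSpace A] [ChartedSpace E A]
  {V : Type*} [TopologicalSpace V] [ChartedSpace F V]
  {μ : A → V} {ψ : ℝ → A → A} {Ω : DiffForm E A 2} {h : V → A}
  (H : IsNonautonomousHamiltonianSystem (F := F) μ ψ Ω h)

/-- The Hamiltonian vector field of the section function, with values in the model space. -/
noncomputable def hamiltonianVector (a : A) : E :=
  modelVector (H.symplectic.hamiltonianVectorField H.sectionFunction) a

theorem modelForm_hamiltonianVector (a : A) (w : E) : Ω.modelForm a ![H.hamiltonianVector a, w] =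
    (modelDeriv H.sectionFunction a w : ℝ) :=
  H.symplectic.modelForm_hamiltonianVectorField H.sectionFunction a w

/-- The Hamiltonian vector field is invariant under the action, since `Ω` is invariant and `F_h`
is invariant up to a constant. -/
theorem modelDeriv_action_hamiltonianVector (s : ℝ) (a : A) :
    (modelDeriv (ψ s) a (H.hamiltonianVector a) : E) = H.hamiltonianVector (ψ s a) := by
  refine sub_eq_zero.1 (H.symplectic.modelForm_nondegenerate (ψ s a) _ fun w => ?_)
  -- Every tangent vector at `ψ s a` is an image under the derivative of `ψ s`.
  obtain ⟨u, rfl⟩ : ∃ u : E, (modelDeriv (ψ s) a u : E) = w := by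
    refine ⟨modelDeriv (ψ (-s)) (ψ s a) w, ?_⟩
    have h1 : ψ (-s) (ψ s a) = a := by
      rw [← H.principal.add_action, neg_add_cancel, H.principal.zero_action]
    have h2 := modelDeriv_comp_apply (f := ψ (-s)) (g := ψ s) (x := ψ s a)
      (H.mdifferentiableAt_action _ _) (H.mdifferentiableAt_action _ _) w
    rw [h1] at h2
    rw [← h2]
    have h3 : (fun z => ψ s (ψ (-s) z)) = fun z => z := funext fun z => by
      rw [← H.principal.add_action, add_neg_cancel, H.principal.zero_action]
    rw [h3, modelDeriv_id_apply]
  have hsub : ∀ x y w : E, Ω.modelForm (ψ s a) ![x - y, w] =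
      Ω.modelForm (ψ s a) ![x, w] - Ω.modelForm (ψ s a) ![y, w] := fun x y w => by
    rw [← ContinuousAlternatingMap.curryLeft_apply_apply, map_sub]
    rfl
  rw [hsub, H.modelForm_action, H.modelForm_hamiltonianVector, H.modelForm_hamiltonianVector,
    H.modelDeriv_sectionFunction_action, sub_self]

/-- The projection to `V` of the Hamiltonian vector field of `F_h` along the section `h`. -/
noncomputable def reeb (v : V) : TangentSpace 𝓘(ℝ, F) v :=
  (modelDeriv μ (h v) (H.hamiltonianVector (h v)) : F)

theorem modelDeriv_proj_hamiltonianVector (a : A) :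
    (modelDeriv μ a (H.hamiltonianVector a) : F) = modelVector H.reeb (μ a) := by
  have h1 := H.modelDeriv_proj_action (H.sectionFunction a) (h (μ a))
    (H.hamiltonianVector (h (μ a)))
  rwa [H.modelDeriv_action_hamiltonianVector, ← H.sectionFunction_spec] at h1

theorem projectsTo_reeb :
    ProjectsTo μ (H.symplectic.hamiltonianVectorField H.sectionFunction) H.reeb :=
  H.modelDeriv_proj_hamiltonianVector

/-- Along the image of `h` the Hamiltonian vector field is tangent to it: its component along the
generator is `dF_h (X) = Ω (X, X) = 0`. -/
theorem modelDeriv_section_reeb (v : V) :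
    (modelDeriv h v (modelVector H.reeb v) : E) = H.hamiltonianVector (h v) := by
  have h1 := H.tangent_splitting v (H.hamiltonianVector (h v))
  have h2 : (modelDeriv H.sectionFunction (h v) (H.hamiltonianVector (h v)) : ℝ) = 0 := by
    rw [← H.modelForm_hamiltonianVector]
    have := Ω.modelForm_skew (h v) (H.hamiltonianVector (h v)) (H.hamiltonianVector (h v))
    linarith
  rw [h2, zero_smul, zero_add] at h1
  exact h1.symm

theorem omegaH_reeb (v : V) (w : F) :
    (omegaH Ω h : DiffForm F V 2).modelForm v ![modelVector H.reeb v, w] = 0 := by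
  rw [omegaH_modelForm, H.modelDeriv_section_reeb, H.modelForm_hamiltonianVector,
    H.modelDeriv_sectionFunction_section]

theorem etaH_reeb (v : V) :
    (etaH ψ Ω h : DiffForm F V 1).modelForm v ![modelVector H.reeb v] = 1 := by
  rw [etaH_modelForm, H.modelDeriv_section_reeb, ← DiffForm.modelForm_skew,
    H.modelForm_hamiltonianVector, H.modelDeriv_sectionFunction_infinitesimalGenerator]

include H

theorem isSmoothVectorField_reeb [IsManifold 𝓘(ℝ, E) ∞ A] [IsManifold 𝓘(ℝ, F) ∞ V] :
    IsSmoothVectorField H.reeb := by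
  have hX := H.symplectic.isSmoothVectorField_hamiltonianVectorField H.contMDiff_sectionFunction
  have h1 := (H.principal.smooth_proj.contMDiff_tangentMap (m := ∞) (by simp)).comp
    (hX.comp H.smooth_section)
  have key : ∀ (p q : V) (_ : p = q) (w : F),
      (⟨p, w⟩ : TangentBundle 𝓘(ℝ, F) V) = ⟨q, w⟩ := by
    rintro p q rfl w
    rfl
  refine h1.congr fun v => ?_
  exact (key _ _ (H.section_spec v) _).symm

theorem isReebVectorField_reeb [IsManifold 𝓘(ℝ, E) ∞ A] [IsManifold 𝓘(ℝ, F) ∞ V] :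
    IsReebVectorField (omegaH Ω h) (etaH ψ Ω h) H.reeb where
  smooth := H.isSmoothVectorField_reeb
  interior_two v := by
    ext w
    refine (congrArg ((omegaH Ω h : DiffForm F V 2).modelForm v) ?_).trans (H.omegaH_reeb v (w 0))
    ext i : 1
    fin_cases i <;> rfl
  interior_one v := H.etaH_reeb v

theorem eq_reeb [IsManifold 𝓘(ℝ, F) ∞ V] {R : (v : V) → TangentSpace 𝓘(ℝ, F) v}
    (hR : IsReebVectorField (omegaH Ω h) (etaH ψ Ω h) R) : R = H.reeb := by
  funext v
  have h1 : ∀ w : F, (omegaH Ω h : DiffForm F V 2).modelForm v ![modelVector R v, w] = 0 :=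
    fun w => congrArg (fun β : F [⋀^Fin 1]→L[ℝ] ℝ => β ![w]) (hR.interior_two v)
  have h2 : (etaH ψ Ω h : DiffForm F V 1).modelForm v ![modelVector R v] = 1 := hR.interior_one v
  have hsub : modelVector R v - modelVector H.reeb v = 0 := by
    refine H.eq_zero_of_omegaH_of_etaH v _ (fun w => ?_) ?_
    · have h3 := h1 w
      have h4 := H.omegaH_reeb v w
      rw [← ContinuousAlternatingMap.curryLeft_apply_apply] at h3 h4 ⊢
      rw [map_sub, ContinuousAlternatingMap.sub_apply, h3, h4, sub_zero]
    · have h4 := H.etaH_reeb v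
      rw [← ContinuousAlternatingMap.curryLeft_apply_apply] at h2 h4 ⊢
      rw [map_sub, ContinuousAlternatingMap.sub_apply, h2, h4, sub_self]
  exact sub_eq_zero.1 hsub

theorem isCosymplectic [IsManifold 𝓘(ℝ, E) ∞ A] [IsManifold 𝓘(ℝ, F) ∞ V] [FiniteDimensional ℝ F]
    [Nonempty V] : IsCosymplectic (omegaH Ω h : DiffForm F V 2) (etaH ψ Ω h : DiffForm F V 1) where
  smooth_two := H.symplectic.smooth.pullback H.smooth_section
  smooth_one := H.isSmooth_etaH
  closed_two := H.symplectic.closed.pullback H.symplectic.smooth H.smooth_section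
  closed_one := H.isClosed_etaH
  volume := by
    have hv : ∀ v : V, ∃ n : ℕ, Module.finrank ℝ F = 2 * n + 1 ∧
        wedge ((etaH ψ Ω h : DiffForm F V 1).modelForm v).toAlternatingMap
          (wedgePow ((omegaH Ω h : DiffForm F V 2).modelForm v).toAlternatingMap n) ≠ 0 := fun v =>
      exists_finrank_eq_and_wedge_ne_zero _ _ (modelVector H.reeb v) (H.omegaH_reeb v)
        (H.etaH_reeb v) (H.eq_zero_of_omegaH_of_etaH v)
    obtain ⟨n, hn, -⟩ := hv (Classical.arbitrary V)
    refine ⟨n, hn, fun v => ?_⟩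
    obtain ⟨m, hm, hne⟩ := hv v
    obtain rfl : m = n := by omega
    exact hne

end IsNonautonomousHamiltonianSystem

theorem theorem5p5
    {E : Type*} [NormedAddCommGroup E] [NormedSpace ℝ E] [FiniteDimensional ℝ E]
    {F : Type*} [NormedAddCommGroup F] [NormedSpace ℝ F] [FiniteDimensional ℝ F]
    {A : Type*} [TopologicalSpace A] [ChartedSpace E A] [IsManifold 𝓘(ℝ, E) ∞ A]
    {V : Type*} [TopologicalSpace V] [ChartedSpace F V] [IsManifold 𝓘(ℝ, F) ∞ V] [Nonempty V]
    (μ : A → V) (ψ : ℝ → A → A) (Ω : DiffForm E A 2) (h : V → A)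
    (H : IsNonautonomousHamiltonianSystem (F := F) μ ψ Ω h) :
    IsCosymplectic (omegaH Ω h : DiffForm F V 2) (etaH ψ Ω h : DiffForm F V 1) ∧
    ContMDiff 𝓘(ℝ, E) 𝓘(ℝ, ℝ) ∞ H.sectionFunction ∧
    IsSmoothVectorField (H.symplectic.hamiltonianVectorField H.sectionFunction) ∧
    ∃ R : (v : V) → TangentSpace 𝓘(ℝ, F) v,
      ProjectsTo μ (H.symplectic.hamiltonianVectorField H.sectionFunction) R ∧
      IsReebVectorField (omegaH Ω h) (etaH ψ Ω h) R ∧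
      ∀ R' : (v : V) → TangentSpace 𝓘(ℝ, F) v,
        IsReebVectorField (omegaH Ω h) (etaH ψ Ω h) R' → R' = R :=
  ⟨H.isCosymplectic, H.contMDiff_sectionFunction,
    H.symplectic.isSmoothVectorField_hamiltonianVectorField H.contMDiff_sectionFunction,
    H.reeb, H.projectsTo_reeb, H.isReebVectorField_reeb, fun _ => H.eq_reeb⟩
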